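/- **Setting.** Let $M$ be a connected, paracompact, Hausdorff smooth manifold and $(M,\mathscr L)$ a Finsler spacetime: $\mathscr L:TM\setminus 0\to\mathbb R$ is smooth, $\mathscr L(x,sv)=s^2\mathscr L(x,v)$ for $s>0$, the Hessian $g_v=\partial^2\mathscr L/\partial v\,\partial v$ has signature $(-,+,\dots,+)$ for every $v\neq 0$, and one connected component of $\{\mathscr L<0\}$ is selected as the future timelike cone; the non-zero vectors of its boundary are the future-directed lightlike vectors. Let $2G^\alpha=g^{\alpha\delta}\big(\frac{\partial^2\mathscr L}{\partial x^\gamma\partial v^\delta}v^\gamma-\frac{\partial\mathscr L}{\partial x^\delta}\big)$ be the spray, $N^\alpha_\mu=\partial G^\alpha/\partial v^\mu$ the non-linear connection, and $D_Xs^\alpha=(\partial_\mu s^\alpha+N^\alpha_\mu(x,s))X^\mu$. Geodesics are the solutions of $D_{\dot x}\dot x=\ddot x+2G(x,\dot x)=0$. Put $R^\mu{}_{\alpha\beta}=\frac{\delta N^\mu_\beta}{\delta x^\alpha}-\frac{\delta N^\mu_\alpha}{\delta x^\beta}$ with $\frac{\delta}{\delta x^\mu}=\frac{\partial}{\partial x^\mu}-N^\nu_\mu\frac{\partial}{\partial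 v^\nu}$, $(Ric_v)_\alpha=R^\mu{}_{\mu\alpha}(x,v)$ and $Ric(v)=Ric_v(v)$. An embedded $C^2$ hypersurface $H\subset M$ is *null* if at every $p\in H$ there is a future-directed lightlike $n\in T_pH$ with $\ker g_n(n,\cdot)=T_pH$. For a field $n$ of such vectors, $H$ is *totally geodesic* in $(M,\mathscr L)$ if the endomorphism $\overline X\mapsto\overline{D_Xn}$ of $TH/n$ vanishes, i.e. $D_Xn\propto n$ for all $X\in TH$. A hypersurface of a Lorentzian manifold with Levi-Civita connection $\nabla$ is *totally geodesic* if $\nabla_XY\in TH$ for all $X\in TH$ and all $C^1$ fields $Y$ tangent to $H$. **Theorem.** Let $H$ be a $C^2$ null hypersurface of $(M,\mathscr L)$, let $n$ be a $C^1$ field on $H$ of future-directed lightlike tangent vectors with $\ker g_n(n,\cdot)=TH$, and let $T$ be a continuous vector field along $H$ with $g_n(T,T)<0$ and $g_n(n,T)<0$ on $H$. Extend $n$ and $T$ to a $C^1$, respectively continuous, vector field on an open neighborhood $U$ of $H$. Then: 1. The inequalities $g_n(T,T)<0$ and $g_n(n,T)<0$ hold on some open neighborhood of $H$ in $U$. For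 each open neighborhood $W\subset U$ of $H$ on which they hold, $(W,g_n)$, time oriented by $T$, is a Lorentzian spacetime with $C^1$ metric, and $H$ is a $C^2$ null hypersurface of it, with the same lightlike tangent field $n$. 2. $H$ is totally geodesic in $(M,\mathscr L)$ if and only if it is totally geodesic in $(W,g_n)$. 3. $D_Xn=\nabla^{g_n}_Xn$ for all $p\in H$ and $X\in T_pM$. There is a function $\kappa$ on $H$ (the surface gravity) with $D_nn=\nabla^{g_n}_nn=\kappa n$ on $H$. If $H$ is totally geodesic, there is a 1-form $\omega:H\to T^*H$ with $D_Xn=\nabla^{g_n}_Xn=\omega(X)n$ for all $X\in TH$. 4. A curve $\gamma:J\to H$, $J$ an open interval, with $\dot\gamma=\alpha n$, $\alpha>0$, is an affinely parametrized geodesic of $(M,\mathscr L)$ if and only if it is one of $(W,g_n)$. 5. Suppose in addition that $(M,\mathscr L)$ satisfies the null convergence condition ($Ric(v)\ge 0$ for every future-directed lightlike $v$) and the equation $\frac{\partial}{\partial v^\alpha}Ric(v)=2(Ric_v)_\alpha$ for all $v\ne0$. If $H$ is totally geodesic, then $i_n\mathrm d\omega=0$ on $TH$ wherever $\omega$ is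 of class $C^1$. -/

import Mathlib

open scoped Manifold ContDiff Topology
open Set

noncomputable section

namespace FinslerNull

/-! ### Calculus in a chart

A point of `E × E` is a pair `(x, v)` (position, velocity); `ℓ` is a Lagrangian in the
coordinates `(x, v)`. -/

section Local

variable {E : Type*} [NormedAddCommGroup E] [NormedSpace ℝ E]

/-- The differential of a function of `(x, v)` in the directions of `v`. -/
def vDiff {F : Type*} [NormedAddCommGroup F] [NormedSpace ℝ F] (f : E × E → F) (z : E × E) :
    E →L[ℝ] F :=
  (fderiv ℝ f z).comp (ContinuousLinearMap.inr ℝ E E)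

/-- The differential of a function of `(x, v)` in the directions of `x`. -/
def hDiff {F : Type*} [NormedAddCommGroup F] [NormedSpace ℝ F] (f : E × E → F) (z : E × E) :
    E →L[ℝ] F :=
  (fderiv ℝ f z).comp (ContinuousLinearMap.inl ℝ E E)

/-- The spray coefficients `G`: the vector with
`2 g_v(G, w) = ∂²ℓ/∂x∂v (v, w) - ∂ℓ/∂x (w)` for all `w`, where `g_v = ∂²ℓ/∂v∂v`. -/
def spray (ℓ : E × E → ℝ) (z : E × E) : E :=
  (1 / 2 : ℝ) • (vDiff (vDiff ℓ) z).inverse (hDiff (vDiff ℓ) z z.2 - hDiff ℓ z)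

/-- The coefficients `N = ∂G/∂v` of the non-linear connection. -/
def nonlinConn (ℓ : E × E → ℝ) (z : E × E) : E →L[ℝ] E :=
  vDiff (spray ℓ) z

/-- `hLiftN ℓ z X Y` is `(δ_X N)(Y)`, with `δ_X = X^μ (∂/∂x^μ - N^ν_μ ∂/∂v^ν)` the derivative
along the horizontal lift of `X`. -/
def hLiftN (ℓ : E × E → ℝ) (z : E × E) : E →L[ℝ] E →L[ℝ] E :=
  hDiff (nonlinConn ℓ) z - (vDiff (nonlinConn ℓ) z).comp (nonlinConn ℓ z)

/-- The curvature of the non-linear connection contracted in its second argument: the map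
`X ↦ R^N(X, Y) = (δ_X N)(Y) - (δ_Y N)(X)`. -/
def nonlinCurv (ℓ : E × E → ℝ) (z : E × E) (Y : E) : E →L[ℝ] E :=
  (hLiftN ℓ z).flip Y - hLiftN ℓ z Y

/-- The Christoffel symbols of the metric `h` (a field of bilinear forms in coordinates): the vector
`Γ(X, Y)` with `h(Γ(X, Y), Z) = (∂_X h(Y, Z) + ∂_Y h(X, Z) - ∂_Z h(X, Y)) / 2` for all `Z`. -/
def christoffel (h : E → E →L[ℝ] E →L[ℝ] ℝ) (x X Y : E) : E :=
  (h x).inverse ((1 / 2 : ℝ) •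
    (fderiv ℝ h x X Y + fderiv ℝ h x Y X -
      ((ContinuousLinearMap.apply ℝ ℝ Y).comp
        ((ContinuousLinearMap.apply ℝ (E →L[ℝ] ℝ) X).comp (fderiv ℝ h x)))))

/-- A bilinear form of signature `(-, +, …, +)`. -/
def IsLorentzian (g : E →L[ℝ] E →L[ℝ] ℝ) : Prop :=
  (∀ X Y, g X Y = g Y X) ∧
    ∃ T, g T T < 0 ∧ ∀ X, g T X = 0 → X ≠ 0 → 0 < g X X

end Local

section Global

variable {E : Type*} [NormedAddCommGroup E] [NormedSpace ℝ E]
  {M : Type*} [TopologicalSpace M] [ChartedSpace E M] [IsManifold 𝓘(ℝ, E) ∞ M]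

/-! ### Coordinates

`chartAt E c` is the preferred chart around `c`. Mathlib's `TangentSpace 𝓘(ℝ, E) c` is `E` itself,
a tangent vector at `c` being identified with its components in `chartAt E c`. So a tensorial
expression at `p` may be computed in the chart `chartAt E p`, at the point `chartAt E p p`. -/

/-- The tangent vector at `q` with given components in the chart around `c`. -/
def ofCoords (c q : M) : E →L[ℝ] TangentSpace 𝓘(ℝ, E) q :=
  (trivializationAt E (TangentSpace 𝓘(ℝ, E) : M → Type _) c).symmL ℝ q

/-- The components, in the chart around `c`, of a tangent vector at `q`. -/
def toCoords (c q : M) : TangentSpace 𝓘(ℝ, E) q →L[ℝ] E :=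
  (trivializationAt E (TangentSpace 𝓘(ℝ, E) : M → Type _) c).continuousLinearMapAt ℝ q

/-- A function on the tangent bundle in the coordinates `(x, v)` induced by the chart around `c`. -/
def lagInChart (L : TangentBundle 𝓘(ℝ, E) M → ℝ) (c : M) (z : E × E) : ℝ :=
  L ⟨(chartAt E c).symm z.1, ofCoords c ((chartAt E c).symm z.1) z.2⟩

/-- A vector field in the chart around `c`. -/
def vecInChart (Y : (q : M) → TangentSpace 𝓘(ℝ, E) q) (c : M) (x : E) : E :=
  toCoords c ((chartAt E c).symm x) (Y ((chartAt E c).symm x))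

/-- A 1-form in the chart around `c`. -/
def formInChart (Ω : (q : M) → TangentSpace 𝓘(ℝ, E) q →L[ℝ] ℝ) (c : M) (x : E) : E →L[ℝ] ℝ :=
  (Ω ((chartAt E c).symm x)).comp (ofCoords c ((chartAt E c).symm x))

/-- A field of bilinear forms in the chart around `c`. -/
def metricInChart
    (g : (q : M) → TangentSpace 𝓘(ℝ, E) q →L[ℝ] TangentSpace 𝓘(ℝ, E) q →L[ℝ] ℝ)
    (c : M) (x : E) : E →L[ℝ] E →L[ℝ] ℝ :=
  (ContinuousLinearMap.precomp ℝ (ofCoords c ((chartAt E c).symm x))).comp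
    ((g ((chartAt E c).symm x)).comp (ofCoords c ((chartAt E c).symm x)))

/-- The exterior derivative `dΩ(X, Y)` at `p` of a 1-form. -/
def extD (Ω : (q : M) → TangentSpace 𝓘(ℝ, E) q →L[ℝ] ℝ) (p : M)
    (X Y : TangentSpace 𝓘(ℝ, E) p) : ℝ :=
  fderiv ℝ (formInChart Ω p) (chartAt E p p) X Y - fderiv ℝ (formInChart Ω p) (chartAt E p p) Y X

/-- The vector field `Y` is of class `C^1` on the set `U`. -/
def IsC1VectorFieldOn (Y : (q : M) → TangentSpace 𝓘(ℝ, E) q) (U : Set M) : Prop :=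
  ContMDiffOn 𝓘(ℝ, E) 𝓘(ℝ, E).tangent 1 (fun q => (⟨q, Y q⟩ : TangentBundle 𝓘(ℝ, E) M)) U

/-- The vector field `Y` is continuous on the set `U`. -/
def IsContVectorFieldOn (Y : (q : M) → TangentSpace 𝓘(ℝ, E) q) (U : Set M) : Prop :=
  ContinuousOn (fun q => (⟨q, Y q⟩ : TangentBundle 𝓘(ℝ, E) M)) U

/-! ### Hypersurfaces -/

/-- An embedded `C^2` hypersurface: locally a regular level set of a `C^2` function. -/
def IsC2Hypersurface (H : Set M) : Prop :=
  ∀ p ∈ H, ∃ (W : Set M) (f : M → ℝ), IsOpen W ∧ p ∈ W ∧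
    ContMDiffOn 𝓘(ℝ, E) 𝓘(ℝ, ℝ) 2 f W ∧
    (∀ q ∈ W, mfderiv 𝓘(ℝ, E) 𝓘(ℝ, ℝ) f q ≠ 0) ∧
    H ∩ W = {q ∈ W | f q = 0}

/-- The tangent space of `H` at `p`: the vectors annihilated by the differentials of the
`C^1` functions that vanish on `H` near `p`. -/
def tangentSpaceOf (H : Set M) (p : M) : Submodule ℝ (TangentSpace 𝓘(ℝ, E) p) where
  carrier := {X | ∀ f : M → ℝ, ContMDiffAt 𝓘(ℝ, E) 𝓘(ℝ, ℝ) 1 f p →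
    (∀ᶠ q in 𝓝[H] p, f q = 0) → mfderiv 𝓘(ℝ, E) 𝓘(ℝ, ℝ) f p X = (0 : ℝ)}
  add_mem' := by
    intro X Y hX hY f hf h0
    rw [map_add, hX f hf h0, hY f hf h0]
    exact add_zero (0 : ℝ)
  zero_mem' := by
    intro f _ _
    exact map_zero _
  smul_mem' := by
    intro r X hX f hf h0
    rw [map_smul, hX f hf h0]
    exact (smul_zero r : r • (0 : ℝ) = 0)

/-! ### Finsler spacetimes -/

/-- The Finsler metric `g_v`: the Hessian at `v` of the Lagrangian restricted to the tangent space
at `p`. -/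
def fundTensor (L : TangentBundle 𝓘(ℝ, E) M → ℝ) (p : M) (v : TangentSpace 𝓘(ℝ, E) p) :
    TangentSpace 𝓘(ℝ, E) p →L[ℝ] TangentSpace 𝓘(ℝ, E) p →L[ℝ] ℝ :=
  fderiv ℝ (fun w : E => fderiv ℝ (fun u : E => L ⟨p, u⟩) w) (v : E)

variable (E M) in
/-- A Finsler spacetime. Only the values of `L` on non-zero vectors matter. -/
structure FinslerSpacetime where
  /-- the Finsler Lagrangian -/
  L : TangentBundle 𝓘(ℝ, E) M → ℝ
  smooth : ContMDiffOn 𝓘(ℝ, E).tangent 𝓘(ℝ, ℝ) ∞ L {v | v.2 ≠ 0}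
  homog : ∀ (p : M) (v : TangentSpace 𝓘(ℝ, E) p) (s : ℝ), v ≠ 0 → 0 < s →
    L ⟨p, s • v⟩ = s ^ 2 * L ⟨p, v⟩
  lorentzian : ∀ (p : M) (v : TangentSpace 𝓘(ℝ, E) p), v ≠ 0 →
    IsLorentzian (E := E) (fundTensor L p v)
  /-- the future timelike cone -/
  future : Set (TangentBundle 𝓘(ℝ, E) M)
  future_component : ∃ v₀ : TangentBundle 𝓘(ℝ, E) M, v₀.2 ≠ 0 ∧ L v₀ < 0 ∧
    future = connectedComponentIn {v | v.2 ≠ 0 ∧ L v < 0} v₀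

namespace FinslerSpacetime

variable (S : FinslerSpacetime E M)

/-- Future-directed lightlike vectors: the non-zero vectors on the boundary of the future
timelike cone. -/
def IsFutureLightlike (p : M) (v : TangentSpace 𝓘(ℝ, E) p) : Prop :=
  v ≠ 0 ∧ (⟨p, v⟩ : TangentBundle 𝓘(ℝ, E) M) ∈ frontier S.future

/-- `v` is a future-directed lightlike vector tangent to `H` at `p` with
`ker g_v(v, ·) = T_p H`. -/
def IsNullNormal (H : Set M) (p : M) (v : TangentSpace 𝓘(ℝ, E) p) : Prop :=
  S.IsFutureLightlike p v ∧ v ∈ tangentSpaceOf H p ∧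
    ∀ X, X ∈ tangentSpaceOf H p ↔ fundTensor S.L p v v X = 0

/-- `C^2` null hypersurfaces of the Finsler spacetime. -/
def IsNullHypersurface (H : Set M) : Prop :=
  IsC2Hypersurface (E := E) H ∧ ∀ p ∈ H, ∃ v, S.IsNullNormal H p v

/-- The covariant derivative `D_X s = ∂_X s + N(x, s)(X)` at `p` of the non-linear connection. -/
def covD (s : (q : M) → TangentSpace 𝓘(ℝ, E) q) (p : M) (X : TangentSpace 𝓘(ℝ, E) p) :
    TangentSpace 𝓘(ℝ, E) p :=
  fderiv ℝ (vecInChart s p) (chartAt E p p) X +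
    nonlinConn (lagInChart S.L p) (chartAt E p p, s p) X

/-- The acceleration `D_γ' γ'` of a curve, i.e. `x'' + 2 G(x, x')`. -/
def accel (γ : ℝ → M) (t : ℝ) : E :=
  deriv (deriv fun s => chartAt E (γ t) (γ s)) t +
    (2 : ℝ) • spray (lagInChart S.L (γ t))
      (chartAt E (γ t) (γ t), deriv (fun s => chartAt E (γ t) (γ s)) t)

/-- `γ` is on `J` an (affinely parametrized) geodesic of the Finsler spacetime. -/
def IsGeodesicOn (γ : ℝ → M) (J : Set ℝ) : Prop :=
  ∀ t ∈ J, ContMDiffAt 𝓘(ℝ, ℝ) 𝓘(ℝ, E) 2 γ t ∧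
    deriv (fun s => chartAt E (γ t) (γ s)) t ≠ 0 ∧ S.accel γ t = 0

/-- `H`, with lightlike tangent field `n`, is totally geodesic: the shape operator
`b : TH/n → TH/n`, induced by `X ↦ D_X n`, vanishes. -/
def IsTotallyGeodesic (H : Set M) (n : (q : M) → TangentSpace 𝓘(ℝ, E) q) : Prop :=
  ∀ p ∈ H, ∀ X ∈ tangentSpaceOf H p, S.covD n p X ∈ Submodule.span ℝ {n p}

/-- The Ricci 1-form `Ric_v(Y) = Tr (X ↦ R^N_v(X, Y))`. -/
def ricciForm (p : M) (v Y : TangentSpace 𝓘(ℝ, E) p) : ℝ :=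
  LinearMap.trace ℝ E (nonlinCurv (lagInChart S.L p) (chartAt E p p, v) Y : E →ₗ[ℝ] E)

/-- The Ricci scalar `Ric(v) = Ric_v(v)`. -/
def ricciScalar (p : M) (v : TangentSpace 𝓘(ℝ, E) p) : ℝ :=
  S.ricciForm p v v

/-- The null convergence condition. -/
def NullConvergence : Prop :=
  ∀ (p : M) (v : TangentSpace 𝓘(ℝ, E) p), S.IsFutureLightlike p v → 0 ≤ S.ricciScalar p v

/-- The equation `∂ Ric(v) / ∂v^α = 2 (Ric_v)_α` (equivalently `χ_α = 0`). -/
def RicciEquation : Prop :=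
  ∀ (p : M) (v : TangentSpace 𝓘(ℝ, E) p), v ≠ 0 → ∀ w : TangentSpace 𝓘(ℝ, E) p,
    fderiv ℝ (fun u : E => S.ricciScalar p u) (v : E) w = 2 * S.ricciForm p v w

/-- The pullback metric `g_s` of the Finsler metric by a vector field `s`. -/
def pullbackMetric (s : (q : M) → TangentSpace 𝓘(ℝ, E) q) (q : M) :
    TangentSpace 𝓘(ℝ, E) q →L[ℝ] TangentSpace 𝓘(ℝ, E) q →L[ℝ] ℝ :=
  fundTensor S.L q (s q)

end FinslerSpacetime

/-! ### Lorentzian spacetimes -/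

namespace Lorentz

/-- `(U, g)`, time oriented by `T`, is a Lorentzian spacetime (with a `C^1` metric). -/
structure IsSpacetime (U : Set M)
    (g : (q : M) → TangentSpace 𝓘(ℝ, E) q →L[ℝ] TangentSpace 𝓘(ℝ, E) q →L[ℝ] ℝ)
    (T : (q : M) → TangentSpace 𝓘(ℝ, E) q) : Prop where
  isOpen : IsOpen U
  contDiff : ∀ p ∈ U, ContDiffAt ℝ 1 (metricInChart g p) (chartAt E p p)
  lorentzian : ∀ p ∈ U, IsLorentzian (E := E) (g p)
  continuous : IsContVectorFieldOn T U
  timelike : ∀ p ∈ U, g p (T p) (T p) < 0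

variable (g : (q : M) → TangentSpace 𝓘(ℝ, E) q →L[ℝ] TangentSpace 𝓘(ℝ, E) q →L[ℝ] ℝ)
  (T : (q : M) → TangentSpace 𝓘(ℝ, E) q)

/-- `v` is a future-directed lightlike vector tangent to `H` at `p` with
`ker g(v, ·) = T_p H`. -/
def IsNullNormal (H : Set M) (p : M) (v : TangentSpace 𝓘(ℝ, E) p) : Prop :=
  (v ≠ 0 ∧ g p v v = 0 ∧ g p v (T p) < 0) ∧ v ∈ tangentSpaceOf H p ∧
    ∀ X, X ∈ tangentSpaceOf H p ↔ g p v X = 0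

/-- `C^2` null hypersurfaces of the Lorentzian spacetime `(U, g)` time oriented by `T`. -/
def IsNullHypersurface (U H : Set M) : Prop :=
  H ⊆ U ∧ IsC2Hypersurface (E := E) H ∧ ∀ p ∈ H, ∃ v, IsNullNormal g T H p v

/-- The Levi-Civita covariant derivative `∇_X Y` at `p`. -/
def nabla (Y : (q : M) → TangentSpace 𝓘(ℝ, E) q) (p : M) (X : TangentSpace 𝓘(ℝ, E) p) :
    TangentSpace 𝓘(ℝ, E) p :=
  fderiv ℝ (vecInChart Y p) (chartAt E p p) X +
    christoffel (metricInChart g p) (chartAt E p p) X (Y p)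

/-- The acceleration `∇_γ' γ'` of a curve. -/
def accel (γ : ℝ → M) (t : ℝ) : E :=
  deriv (deriv fun s => chartAt E (γ t) (γ s)) t +
    christoffel (metricInChart g (γ t)) (chartAt E (γ t) (γ t))
      (deriv (fun s => chartAt E (γ t) (γ s)) t) (deriv (fun s => chartAt E (γ t) (γ s)) t)

/-- `γ` is on `J` an (affinely parametrized) geodesic of `g`. -/
def IsGeodesicOn (γ : ℝ → M) (J : Set ℝ) : Prop :=
  ∀ t ∈ J, ContMDiffAt 𝓘(ℝ, ℝ) 𝓘(ℝ, E) 2 γ t ∧ accel g γ t = 0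

/-- `H` is totally geodesic: `∇_X Y` is tangent to `H` for all `X` and all (local, `C^1`) vector
fields `Y` tangent to `H`. -/
def IsTotallyGeodesic (H : Set M) : Prop :=
  ∀ p ∈ H, ∀ X ∈ tangentSpaceOf H p, ∀ Y : (q : M) → TangentSpace 𝓘(ℝ, E) q,
    ContMDiffAt 𝓘(ℝ, E) 𝓘(ℝ, E).tangent 1 (fun q => (⟨q, Y q⟩ : TangentBundle 𝓘(ℝ, E) M)) p →
    (∀ᶠ q in 𝓝[H] p, Y q ∈ tangentSpaceOf H q) → nabla g Y p X ∈ tangentSpaceOf H p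

end Lorentz

end Global

end FinslerNull

end

/-! Everything rests on one pointwise identity: along `H` the non-linear connection and the
Levi-Civita connection of `g_n` act on `n` in the same way, N(x, n)(X) = Γ(X, n)
(`nonlinConn_eq_christoffel`).

Write ℓ for the Lagrangian in a chart, C = ∂³ℓ/∂v³, and α = g_n(n, ·) = ∂ℓ/∂v along n.
Differentiating the spray equation vertically expresses 2 g_v(N X, Z) through the derivatives of ℓ
(`metric_nonlinConn`). The Koszul formula for x ↦ g_{n(x)} gives the same terms, except that -2 C(G,
X, Z) is replaced by C(∂_n n, X, Z); the other terms created by differentiating n contain C with an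
argument n and vanish by homogeneity. The difference is C(∂_n n + 2G, X, Z), so it suffices that D_n
n = ∂_n n + 2G is proportional to n. It is: α is proportional to df on `H`, hence dα vanishes on
pairs of tangent vectors (`fderiv_conormal_comm`), and together with ℓ(x, n) = 0 on `H` this makes
D_n n orthogonal to T`H` (`covariantDeriv_self_mem_span`).

Surface gravity and connection form follow at once. The two notions of totally geodesic agree by
differentiating g_n(n, Y) = 0 along `H`. The accelerations of the generators agree because 2 G(n) =
N(n)(n) = Γ(n, n).

For i_n dω = 0, differentiate D n = ω ⊗ n once more along `H`: the curvature is R(X, Y) = dω(X, Y) n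
for tangent X, Y (`nonlinCurv_eq`). Since ℓ is horizontally constant, R takes values in ker α, so
the trace over the whole space is Ric_n(Y) = dω(n, Y) for tangent Y (`trace_nonlinCurv`). Hence
Ric(n) = 0, and under null convergence n minimizes Ric locally on the light cone of its fibre. That
cone is there a smooth level set of L consisting of future-directed vectors
(`eventually_isFutureLightlike`), so by Lagrange multipliers dRic is a multiple of α and vanishes on
T`H`; the Ricci equation turns this into Ric_n(X) = 0, that is dω(n, X) = 0. -/

noncomputable section

namespace FinslerNull

/-! ### Finsler calculus in a chart: homogeneity, spray, non-linear connection, curvature. -/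

section LocalFinsler

variable {E : Type*} [NormedAddCommGroup E] [NormedSpace ℝ E]
  {F : Type*} [NormedAddCommGroup F] [NormedSpace ℝ F]

theorem vDiff_apply (f : E × E → F) (z : E × E) (w : E) : vDiff f z w = fderiv ℝ f z (0, w) := by
  simp [vDiff]

theorem hDiff_apply (f : E × E → F) (z : E × E) (w : E) : hDiff f z w = fderiv ℝ f z (w, 0) := by
  simp [hDiff]

theorem fderiv_apply_apply {V P Q : Type*} [NormedAddCommGroup V] [NormedSpace ℝ V]
    [NormedAddCommGroup P] [NormedSpace ℝ P] [NormedAddCommGroup Q] [NormedSpace ℝ Q]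
    {A : V → P →L[ℝ] Q →L[ℝ] F} {z : V} (hA : DifferentiableAt ℝ A z) (a : P) (b : Q) (u : V) :
    fderiv ℝ (fun y => A y a b) z u = fderiv ℝ A z u a b := by
  have h := (hA.hasFDerivAt.clm_apply (hasFDerivAt_const a z)).clm_apply (hasFDerivAt_const b z)
  rw [h.fderiv]
  simp

theorem contDiffAt_vDiff {f : E × E → F} {z : E × E} (hf : ContDiffAt ℝ ∞ f z) :
    ContDiffAt ℝ ∞ (vDiff f) z := by
  have h : ContDiffAt ℝ ∞ (fderiv ℝ f) z := hf.fderiv_right (by simp)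
  exact h.clm_comp contDiffAt_const

theorem contDiffAt_hDiff {f : E × E → F} {z : E × E} (hf : ContDiffAt ℝ ∞ f z) :
    ContDiffAt ℝ ∞ (hDiff f) z := by
  have h : ContDiffAt ℝ ∞ (fderiv ℝ f) z := hf.fderiv_right (by simp)
  exact h.clm_comp contDiffAt_const

theorem fderiv_fderiv_differentiableAt {f : E × E → F} {z : E × E} (hf : ContDiffAt ℝ ∞ f z) :
    DifferentiableAt ℝ (fderiv ℝ f) z :=
  (hf.fderiv_right (m := ∞) (by simp)).differentiableAt (by simp)

theorem fderiv_vDiff_apply {f : E × E → F} {z : E × E} (hf : ContDiffAt ℝ ∞ f z) (u : E × E)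
    (w : E) : fderiv ℝ (vDiff f) z u w = fderiv ℝ (fderiv ℝ f) z u (0, w) := by
  have h := (fderiv_fderiv_differentiableAt hf).hasFDerivAt.clm_comp
    (hasFDerivAt_const (ContinuousLinearMap.inr ℝ E E) z)
  change fderiv ℝ (fun y => (fderiv ℝ f y).comp (ContinuousLinearMap.inr ℝ E E)) z u w = _
  rw [h.fderiv]
  simp

theorem fderiv_hDiff_apply {f : E × E → F} {z : E × E} (hf : ContDiffAt ℝ ∞ f z) (u : E × E)
    (w : E) : fderiv ℝ (hDiff f) z u w = fderiv ℝ (fderiv ℝ f) z u (w, 0) := by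
  have h := (fderiv_fderiv_differentiableAt hf).hasFDerivAt.clm_comp
    (hasFDerivAt_const (ContinuousLinearMap.inl ℝ E E) z)
  change fderiv ℝ (fun y => (fderiv ℝ f y).comp (ContinuousLinearMap.inl ℝ E E)) z u w = _
  rw [h.fderiv]
  simp

theorem fderiv_fderiv_comm {f : E × E → F} {z : E × E} (hf : ContDiffAt ℝ ∞ f z) (u w : E × E) :
    fderiv ℝ (fderiv ℝ f) z u w = fderiv ℝ (fderiv ℝ f) z w u :=
  hf.isSymmSndFDerivAt (by simpa using ENat.LEInfty.out) u w

theorem eventually_contDiffAt {f : E × E → F} {z : E × E} (hf : ContDiffAt ℝ ∞ f z) :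
    ∀ᶠ y in 𝓝 z, ContDiffAt ℝ 2 f y :=
  (hf.of_le (m := 2) ENat.LEInfty.out).eventually (by simp)

/-- Symmetry of the second derivative holds at all nearby points, so it can be differentiated once
more. -/
theorem fderiv_fderiv_fderiv_comm {f : E × E → F} {z : E × E} (hf : ContDiffAt ℝ ∞ f z)
    (u v w : E × E) : fderiv ℝ (fderiv ℝ (fderiv ℝ f)) z u v w =
      fderiv ℝ (fderiv ℝ (fderiv ℝ f)) z u w v := by
  have h1 : ContDiffAt ℝ ∞ (fderiv ℝ f) z := hf.fderiv_right (by simp)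
  have h2 : DifferentiableAt ℝ (fderiv ℝ (fderiv ℝ f)) z := fderiv_fderiv_differentiableAt h1
  have he : (fun y => fderiv ℝ (fderiv ℝ f) y v w) =ᶠ[𝓝 z]
      fun y => fderiv ℝ (fderiv ℝ f) y w v := by
    filter_upwards [eventually_contDiffAt hf] with y hy
    exact hy.isSymmSndFDerivAt (by simp) v w
  rw [← fderiv_apply_apply h2, ← fderiv_apply_apply h2, he.fderiv_eq]

/-- `f (x, v)` is positively homogeneous of degree `k` in `v ≠ 0`, for `x ∈ O`. -/
def HomogOn (k : ℕ) (f : E × E → F) (O : Set E) : Prop :=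
  ∀ x ∈ O, ∀ v : E, v ≠ 0 → ∀ s : ℝ, 0 < s → f (x, s • v) = s ^ k • f (x, v)

theorem HomogOn.eventuallyEq {k : ℕ} {f : E × E → F} {O : Set E} (hf : HomogOn k f O)
    (hO : IsOpen O) {x v : E} (hx : x ∈ O) (hv : v ≠ 0) {s : ℝ} (hs : 0 < s) :
    (fun z : E × E => f (z.1, s • z.2)) =ᶠ[𝓝 (x, v)] fun z => s ^ k • f z := by
  have h1 : ∀ᶠ z : E × E in 𝓝 (x, v), z.1 ∈ O :=
    continuous_fst.continuousAt.eventually_mem (hO.mem_nhds hx)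
  have h2 : ∀ᶠ z : E × E in 𝓝 (x, v), z.2 ≠ 0 :=
    continuous_snd.continuousAt.eventually_ne hv
  filter_upwards [h1, h2] with z hz1 hz2
  exact hf z.1 hz1 z.2 hz2 s hs

/-- Chain rule for the dilation (x, v) ↦ (x, s v). Keeping the factor s on the vertical argument
lets one identity serve both cases: vertical derivatives lower the degree by one, horizontal ones
keep it. -/
theorem HomogOn.fderiv {k : ℕ} {f : E × E → F} {O : Set E} (hf : HomogOn k f O)
    (hO : IsOpen O) {x v : E} (hx : x ∈ O) (hv : v ≠ 0) {s : ℝ} (hs : 0 < s) (u w : E) :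
    fderiv ℝ f (x, s • v) (u, s • w) = s ^ k • fderiv ℝ f (x, v) (u, w) := by
  let σ : (E × E) ≃L[ℝ] (E × E) := (ContinuousLinearEquiv.refl ℝ E).prodCongr
    (ContinuousLinearEquiv.smulLeft (Units.mk0 s hs.ne') : E ≃L[ℝ] E)
  have hσ : ∀ z : E × E, σ z = (z.1, s • z.2) := fun z => rfl
  have h := (hf.eventuallyEq hO hx hv hs).fderiv_eq (𝕜 := ℝ)
  have h' : _root_.fderiv ℝ (f ∘ σ) (x, v) =
      (_root_.fderiv ℝ f (σ (x, v))).comp (σ : E × E →L[ℝ] E × E) :=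
    σ.comp_right_fderiv
  change _root_.fderiv ℝ (f ∘ σ) (x, v) = _ at h
  rw [h', show (fun z => s ^ k • f z) = s ^ k • f from rfl,
    fderiv_const_smul_field (𝕜 := ℝ)] at h
  simpa [hσ] using congrArg (fun A => A (u, w)) h

theorem HomogOn.vDiff {k : ℕ} {f : E × E → F} {O : Set E} (hf : HomogOn (k + 1) f O)
    (hO : IsOpen O) : HomogOn k (vDiff f) O := by
  intro x hx v hv s hs
  ext w
  have h := hf.fderiv hO hx hv hs 0 w
  rw [smul_apply, vDiff_apply, vDiff_apply]
  have h0 : ((0 : E), s • w) = s • ((0 : E), w) := by simp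
  rw [h0, map_smul, pow_succ', mul_smul] at h
  exact smul_right_injective _ hs.ne' h

theorem HomogOn.hDiff {k : ℕ} {f : E × E → F} {O : Set E} (hf : HomogOn k f O)
    (hO : IsOpen O) : HomogOn k (hDiff f) O := by
  intro x hx v hv s hs
  ext w
  have h := hf.fderiv hO hx hv hs w 0
  rw [smul_apply, hDiff_apply, hDiff_apply]
  simpa using h

/-- Euler's identity. -/
theorem HomogOn.euler {k : ℕ} {f : E × E → F} {O : Set E} (hf : HomogOn k f O)
    {x v : E} (hx : x ∈ O) (hv : v ≠ 0) (hd : DifferentiableAt ℝ f (x, v)) :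
    FinslerNull.vDiff f (x, v) v = (k : ℝ) • f (x, v) := by
  have h1 : HasDerivAt (fun s : ℝ => (x, s • v)) (0, v) 1 := by
    have := ((hasDerivAt_id (1 : ℝ)).smul_const v)
    simpa using (hasDerivAt_const (1 : ℝ) x).prodMk this
  have h2 : HasDerivAt (fun s : ℝ => f (x, s • v)) (_root_.fderiv ℝ f (x, v) (0, v)) 1 := by
    have hd' : HasFDerivAt f (_root_.fderiv ℝ f (x, v)) (x, (1 : ℝ) • v) := by
      rw [one_smul]; exact hd.hasFDerivAt
    exact hd'.comp_hasDerivAt (1 : ℝ) h1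
  have h3 : HasDerivAt (fun s : ℝ => s ^ k • f (x, v)) ((k : ℝ) • f (x, v)) 1 := by
    simpa using (hasDerivAt_pow k (1 : ℝ)).smul_const (f (x, v))
  have he : (fun s : ℝ => f (x, s • v)) =ᶠ[𝓝 1] fun s => s ^ k • f (x, v) := by
    filter_upwards [lt_mem_nhds (zero_lt_one (α := ℝ))] with s hs
    exact hf x hx v hv s hs
  rw [vDiff_apply]
  exact h2.unique (h3.congr_of_eventuallyEq he)

/-- A Lagrangian, in coordinates `(x, v)` with `x ∈ O`, that is smooth, positively homogeneous of
degree two and of Lorentzian signature for `v ≠ 0`. -/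
structure IsLocalFinsler (ℓ : E × E → ℝ) (O : Set E) : Prop where
  isOpen : IsOpen O
  smooth : ContDiffOn ℝ ∞ ℓ (O ×ˢ {0}ᶜ)
  homog : HomogOn 2 ℓ O
  lorentzian : ∀ x ∈ O, ∀ v : E, v ≠ 0 → IsLorentzian (vDiff (vDiff ℓ) (x, v))

/-- Nondegeneracy: a vector in the kernel is orthogonal to the timelike T, and on the orthogonal
complement of T the form is positive definite. -/
theorem IsLorentzian.eq_zero {g : E →L[ℝ] E →L[ℝ] ℝ} (hg : IsLorentzian g) {X : E}
    (h : ∀ Y, g X Y = 0) : X = 0 := by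
  obtain ⟨hs, T, -, hT⟩ := hg
  by_contra hX
  have := hT X ((hs T X).trans (h T)) hX
  rw [h X] at this
  exact lt_irrefl _ this

theorem IsLorentzian.isInvertible [FiniteDimensional ℝ E] {g : E →L[ℝ] E →L[ℝ] ℝ}
    (hg : IsLorentzian g) : g.IsInvertible := by
  have hinj : Function.Injective (g : E →ₗ[ℝ] E →L[ℝ] ℝ) := by
    rw [← LinearMap.ker_eq_bot, LinearMap.ker_eq_bot']
    intro X hX
    apply hg.eq_zero
    intro Y
    exact congrArg (fun A : E →L[ℝ] ℝ => A Y) hX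
  have hdim : Module.finrank ℝ E = Module.finrank ℝ (E →L[ℝ] ℝ) := by
    rw [← (LinearMap.toContinuousLinearMap : (E →ₗ[ℝ] ℝ) ≃ₗ[ℝ] E →L[ℝ] ℝ).finrank_eq]
    exact (Subspace.dual_finrank_eq).symm
  let e := (LinearEquiv.ofInjectiveOfFinrankEq (g : E →ₗ[ℝ] E →L[ℝ] ℝ) hinj hdim)
  exact ⟨e.toContinuousLinearEquiv, by ext; rfl⟩

theorem IsLorentzian.apply_inverse [FiniteDimensional ℝ E] {g : E →L[ℝ] E →L[ℝ] ℝ}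
    (hg : IsLorentzian g) (a : E →L[ℝ] ℝ) : g (g.inverse a) = a := by
  obtain ⟨e, rfl⟩ := hg.isInvertible
  simp

theorem IsLorentzian.ext_left {g : E →L[ℝ] E →L[ℝ] ℝ} (hg : IsLorentzian g) {X X' : E}
    (h : ∀ Y, g X Y = g X' Y) : X = X' :=
  sub_eq_zero.1 (hg.eq_zero fun Y => by rw [map_sub, sub_apply, h, sub_self])

namespace IsLocalFinsler

variable {ℓ : E × E → ℝ} {O : Set E} (hℓ : IsLocalFinsler ℓ O) {x v : E}
include hℓ

theorem isOpen_prod : IsOpen (O ×ˢ ({0}ᶜ : Set E)) :=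
  hℓ.isOpen.prod isOpen_compl_singleton

theorem mem_nhds (hx : x ∈ O) (hv : v ≠ 0) : O ×ˢ ({0}ᶜ : Set E) ∈ 𝓝 (x, v) :=
  hℓ.isOpen_prod.mem_nhds ⟨hx, hv⟩

theorem contDiffAt (hx : x ∈ O) (hv : v ≠ 0) : ContDiffAt ℝ ∞ ℓ (x, v) :=
  hℓ.smooth.contDiffAt (hℓ.mem_nhds hx hv)

theorem contDiffAt_metric (hx : x ∈ O) (hv : v ≠ 0) :
    ContDiffAt ℝ ∞ (vDiff (vDiff ℓ)) (x, v) :=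
  contDiffAt_vDiff (contDiffAt_vDiff (hℓ.contDiffAt hx hv))

theorem metric_apply (hx : x ∈ O) (hv : v ≠ 0) (a b : E) :
    vDiff (vDiff ℓ) (x, v) a b = fderiv ℝ (fderiv ℝ ℓ) (x, v) (0, a) (0, b) := by
  rw [vDiff_apply, fderiv_vDiff_apply (hℓ.contDiffAt hx hv)]

theorem fderiv_metric_apply (hx : x ∈ O) (hv : v ≠ 0) (u : E × E) (a b : E) :
    fderiv ℝ (vDiff (vDiff ℓ)) (x, v) u a b =
      fderiv ℝ (fderiv ℝ (fderiv ℝ ℓ)) (x, v) u (0, a) (0, b) := by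
  have h := hℓ.contDiffAt hx hv
  have h1 : ContDiffAt ℝ ∞ (fderiv ℝ ℓ) (x, v) := h.fderiv_right (by simp)
  have h2 : DifferentiableAt ℝ (fderiv ℝ (fderiv ℝ ℓ)) (x, v) := fderiv_fderiv_differentiableAt h1
  have h3 : DifferentiableAt ℝ (vDiff (vDiff ℓ)) (x, v) :=
    (hℓ.contDiffAt_metric hx hv).differentiableAt (by simp)
  have he : (fun z => vDiff (vDiff ℓ) z a b) =ᶠ[𝓝 (x, v)]
      fun z => fderiv ℝ (fderiv ℝ ℓ) z (0, a) (0, b) := by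
    filter_upwards [hℓ.mem_nhds hx hv] with z hz
    exact hℓ.metric_apply hz.1 hz.2 a b
  rw [← fderiv_apply_apply h3, ← fderiv_apply_apply h2, he.fderiv_eq]

/-- `g_v(v, ·) = ∂ℓ/∂v`. -/
theorem metric_self (hx : x ∈ O) (hv : v ≠ 0) :
    vDiff (vDiff ℓ) (x, v) v = vDiff ℓ (x, v) := by
  have h : HomogOn 1 (vDiff ℓ) O := hℓ.homog.vDiff hℓ.isOpen
  simpa using h.euler hx hv ((contDiffAt_vDiff (hℓ.contDiffAt hx hv)).differentiableAt (by simp))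

theorem vDiff_self (hx : x ∈ O) (hv : v ≠ 0) : vDiff ℓ (x, v) v = 2 * ℓ (x, v) := by
  simpa using hℓ.homog.euler hx hv ((hℓ.contDiffAt hx hv).differentiableAt (by simp))

/-- The Cartan torsion vanishes on `v`. -/
theorem cartan_self (hx : x ∈ O) (hv : v ≠ 0) (a b : E) :
    fderiv ℝ (fderiv ℝ (fderiv ℝ ℓ)) (x, v) (0, v) (0, a) (0, b) = 0 := by
  have h : HomogOn 0 (vDiff (vDiff ℓ)) O :=
    HomogOn.vDiff (hℓ.homog.vDiff hℓ.isOpen) hℓ.isOpen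
  have := h.euler hx hv ((hℓ.contDiffAt_metric hx hv).differentiableAt (by simp))
  rw [← hℓ.fderiv_metric_apply hx hv, ← vDiff_apply, this]
  simp

/-- Symmetries of the third derivative. -/
theorem third_comm (hx : x ∈ O) (hv : v ≠ 0) (u w y : E × E) :
    fderiv ℝ (fderiv ℝ (fderiv ℝ ℓ)) (x, v) u w y =
      fderiv ℝ (fderiv ℝ (fderiv ℝ ℓ)) (x, v) w u y := by
  have h1 : ContDiffAt ℝ ∞ (fderiv ℝ ℓ) (x, v) := (hℓ.contDiffAt hx hv).fderiv_right (by simp)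
  rw [fderiv_fderiv_comm h1]

theorem third_comm_last (hx : x ∈ O) (hv : v ≠ 0) (u w y : E × E) :
    fderiv ℝ (fderiv ℝ (fderiv ℝ ℓ)) (x, v) u w y =
      fderiv ℝ (fderiv ℝ (fderiv ℝ ℓ)) (x, v) u y w :=
  fderiv_fderiv_fderiv_comm (hℓ.contDiffAt hx hv) u w y

theorem second_comm (hx : x ∈ O) (hv : v ≠ 0) (u w : E × E) :
    fderiv ℝ (fderiv ℝ ℓ) (x, v) u w = fderiv ℝ (fderiv ℝ ℓ) (x, v) w u :=
  fderiv_fderiv_comm (hℓ.contDiffAt hx hv) u w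

theorem second_hDiff_self (hx : x ∈ O) (hv : v ≠ 0) (X : E) :
    fderiv ℝ (fderiv ℝ ℓ) (x, v) (X, 0) (0, v) = 2 * fderiv ℝ ℓ (x, v) (X, 0) := by
  have h : HomogOn 2 (hDiff ℓ) O := hℓ.homog.hDiff hℓ.isOpen
  have := h.euler hx hv ((contDiffAt_hDiff (hℓ.contDiffAt hx hv)).differentiableAt (by simp))
  have := congrArg (fun A => A X) this
  rw [hℓ.second_comm hx hv, ← fderiv_hDiff_apply (hℓ.contDiffAt hx hv), ← vDiff_apply]
  simpa [hDiff_apply] using this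

/-- The identity g_v(v, a) = ∂ℓ/∂v (a) is differentiated in x with v held fixed. With `cartan_self`
it removes the third derivatives having an argument v when N is compared with the Christoffel
symbols. -/
theorem third_hDiff_self (hx : x ∈ O) (hv : v ≠ 0) (X a : E) :
    fderiv ℝ (fderiv ℝ (fderiv ℝ ℓ)) (x, v) (X, 0) (0, v) (0, a) =
      fderiv ℝ (fderiv ℝ ℓ) (x, v) (X, 0) (0, a) := by
  have h1 := hℓ.contDiffAt hx hv
  have h : HomogOn 1 (vDiff ℓ) O := hℓ.homog.vDiff hℓ.isOpen
  have h2 : ContDiffAt ℝ ∞ (vDiff (vDiff ℓ)) (x, v) := hℓ.contDiffAt_metric hx hv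
  have e1 : HasFDerivAt (fun z : E × E => vDiff (vDiff ℓ) z z.2 a) _ (x, v) :=
    ((h2.differentiableAt (by simp)).hasFDerivAt.clm_apply hasFDerivAt_snd).clm_apply
      (hasFDerivAt_const a (x, v))
  have e2 : HasFDerivAt (fun z : E × E => vDiff ℓ z a) _ (x, v) :=
    ((contDiffAt_vDiff h1).differentiableAt (by simp)).hasFDerivAt.clm_apply
      (hasFDerivAt_const a (x, v))
  have he : (fun z : E × E => vDiff (vDiff ℓ) z z.2 a) =ᶠ[𝓝 (x, v)] fun z => vDiff ℓ z a := by
    filter_upwards [hℓ.mem_nhds hx hv] with z hz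
    rw [hℓ.metric_self hz.1 hz.2]
  have := congrArg (fun A => A (X, 0)) ((e1.congr_of_eventuallyEq he.symm).unique e2)
  simpa [hℓ.fderiv_metric_apply hx hv, fderiv_vDiff_apply h1] using this

theorem homogOn_spray : HomogOn 2 (spray ℓ) O := by
  intro x hx v hv s hs
  have hg : HomogOn 0 (vDiff (vDiff ℓ)) O :=
    HomogOn.vDiff (hℓ.homog.vDiff hℓ.isOpen) hℓ.isOpen
  have h1 : HomogOn 1 (hDiff (vDiff ℓ)) O := (hℓ.homog.vDiff hℓ.isOpen).hDiff hℓ.isOpen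
  have h2 : HomogOn 2 (hDiff ℓ) O := hℓ.homog.hDiff hℓ.isOpen
  have e : hDiff (vDiff ℓ) (x, s • v) (s • v) - hDiff ℓ (x, s • v) =
      s ^ 2 • (hDiff (vDiff ℓ) (x, v) v - hDiff ℓ (x, v)) := by
    rw [h1 x hx v hv s hs, h2 x hx v hv s hs, smul_apply, map_smul, smul_smul,
      smul_sub, pow_one, sq]
  rw [spray, spray]
  dsimp only
  rw [e, hg x hx v hv s hs, pow_zero, one_smul, map_smul, smul_comm]

variable [FiniteDimensional ℝ E]

theorem spray_eq (hx : x ∈ O) (hv : v ≠ 0) :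
    (2 : ℝ) • vDiff (vDiff ℓ) (x, v) (spray ℓ (x, v)) =
      hDiff (vDiff ℓ) (x, v) v - hDiff ℓ (x, v) := by
  rw [spray, map_smul, (hℓ.lorentzian x hx v hv).apply_inverse, smul_smul]
  norm_num

theorem contDiffAt_spray (hx : x ∈ O) (hv : v ≠ 0) : ContDiffAt ℝ ∞ (spray ℓ) (x, v) := by
  have h1 := hℓ.contDiffAt hx hv
  have hi : ContDiffAt ℝ ∞ (fun z => (vDiff (vDiff ℓ) z).inverse) (x, v) :=
    ((hℓ.lorentzian x hx v hv).isInvertible.contDiffAt_map_inverse).comp _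
      (hℓ.contDiffAt_metric hx hv)
  have hr : ContDiffAt ℝ ∞ (fun z : E × E => hDiff (vDiff ℓ) z z.2 - hDiff ℓ z) (x, v) :=
    ((contDiffAt_hDiff (contDiffAt_vDiff h1)).clm_apply contDiffAt_snd).sub (contDiffAt_hDiff h1)
  exact (hi.clm_apply hr).const_smul (1 / 2 : ℝ)

theorem contDiffAt_nonlinConn (hx : x ∈ O) (hv : v ≠ 0) :
    ContDiffAt ℝ ∞ (nonlinConn ℓ) (x, v) :=
  contDiffAt_vDiff (hℓ.contDiffAt_spray hx hv)

theorem nonlinConn_self (hx : x ∈ O) (hv : v ≠ 0) :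
    nonlinConn ℓ (x, v) v = (2 : ℝ) • spray ℓ (x, v) := by
  simpa [nonlinConn] using hℓ.homogOn_spray.euler hx hv
    ((hℓ.contDiffAt_spray hx hv).differentiableAt (by simp))

/-- Euler's identity for N, of degree one in v. In `nonlinCurv_eq` it handles the part of the
derivative of n that is proportional to n. -/
theorem vDiff_nonlinConn_self (hx : x ∈ O) (hv : v ≠ 0) :
    vDiff (nonlinConn ℓ) (x, v) v = nonlinConn ℓ (x, v) := by
  have h : HomogOn 1 (nonlinConn ℓ) O := HomogOn.vDiff hℓ.homogOn_spray hℓ.isOpen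
  simpa using h.euler hx hv ((hℓ.contDiffAt_nonlinConn hx hv).differentiableAt (by simp))

/-- The non-linear connection in terms of the derivatives of the Lagrangian. -/
theorem metric_nonlinConn (hx : x ∈ O) (hv : v ≠ 0) (X w : E) :
    2 * vDiff (vDiff ℓ) (x, v) (nonlinConn ℓ (x, v) X) w =
      fderiv ℝ (fderiv ℝ (fderiv ℝ ℓ)) (x, v) (v, 0) (0, X) (0, w) +
      fderiv ℝ (fderiv ℝ ℓ) (x, v) (X, 0) (0, w) - fderiv ℝ (fderiv ℝ ℓ) (x, v) (w, 0) (0, X) -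
      2 * fderiv ℝ (fderiv ℝ (fderiv ℝ ℓ)) (x, v) (0, spray ℓ (x, v)) (0, X) (0, w) := by
  have h := hℓ.contDiffAt hx hv
  have h1 : ContDiffAt ℝ ∞ (fderiv ℝ ℓ) (x, v) := h.fderiv_right (by simp)
  have h2 : DifferentiableAt ℝ (fderiv ℝ (fderiv ℝ ℓ)) (x, v) := fderiv_fderiv_differentiableAt h1
  have e1 : HasFDerivAt (fun z : E × E => (2 : ℝ) * vDiff (vDiff ℓ) z (spray ℓ z) w) _ (x, v) :=
    ((((hℓ.contDiffAt_metric hx hv).differentiableAt (by simp)).hasFDerivAt.clm_apply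
      ((hℓ.contDiffAt_spray hx hv).differentiableAt (by simp)).hasFDerivAt).clm_apply
      (hasFDerivAt_const w (x, v))).const_mul 2
  have hi : HasFDerivAt (fun z : E × E => (z.2, (0 : E)))
      ((ContinuousLinearMap.inl ℝ E E).comp (ContinuousLinearMap.snd ℝ E E)) (x, v) :=
    ((ContinuousLinearMap.inl ℝ E E).comp (ContinuousLinearMap.snd ℝ E E)).hasFDerivAt
  have e2 : HasFDerivAt (fun z : E × E => fderiv ℝ (fderiv ℝ ℓ) z (z.2, 0) (0, w) -
      fderiv ℝ ℓ z (w, 0)) _ (x, v) :=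
    ((h2.hasFDerivAt.clm_apply hi).clm_apply (hasFDerivAt_const ((0 : E), w) (x, v))).sub
      ((h1.differentiableAt (by simp)).hasFDerivAt.clm_apply
        (hasFDerivAt_const (w, (0 : E)) (x, v)))
  -- The spray equation paired with w holds near (x, v). Its vertical derivative in the direction X
  -- is the claim; the term with the third vertical derivative comes from differentiating the metric
  -- on the left.
  have he : (fun z : E × E => (2 : ℝ) * vDiff (vDiff ℓ) z (spray ℓ z) w) =ᶠ[𝓝 (x, v)]
      fun z : E × E => fderiv ℝ (fderiv ℝ ℓ) z (z.2, 0) (0, w) - fderiv ℝ ℓ z (w, 0) := by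
    filter_upwards [hℓ.mem_nhds hx hv] with z hz
    have := congrArg (fun A => A w) (hℓ.spray_eq hz.1 hz.2)
    simpa [hDiff_apply, fderiv_vDiff_apply (hℓ.contDiffAt hz.1 hz.2)] using this
  have := congrArg (fun A => A (0, X)) ((e1.congr_of_eventuallyEq he.symm).unique e2)
  simp [hℓ.fderiv_metric_apply hx hv] at this
  rw [← vDiff_apply] at this
  rw [nonlinConn]
  rw [hℓ.second_comm hx hv (w, 0), hℓ.third_comm hx hv (v, 0),
    hℓ.third_comm hx hv (0, spray ℓ (x, v))]
  linarith

/-- The Lagrangian is horizontally constant. -/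
theorem hDiff_eq (hx : x ∈ O) (hv : v ≠ 0) (X : E) :
    fderiv ℝ ℓ (x, v) (0, nonlinConn ℓ (x, v) X) = fderiv ℝ ℓ (x, v) (X, 0) := by
  -- For w = v the Cartan term vanishes, the first and third terms cancel, and the second is 2 ∂ℓ/∂x
  -- (X); on the left g_v(·, v) = ∂ℓ/∂v.
  have h := hℓ.metric_nonlinConn hx hv X v
  rw [hℓ.third_comm_last hx hv (v, 0), hℓ.third_hDiff_self hx hv, hℓ.second_hDiff_self hx hv,
    hℓ.third_comm_last hx hv (0, _), hℓ.third_comm hx hv (0, _), hℓ.cartan_self hx hv,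
    (hℓ.lorentzian x hx v hv).1, hℓ.metric_self hx hv, vDiff_apply] at h
  linarith

/-- The curvature of the non-linear connection takes values in the kernel of `∂ℓ/∂v`. -/
theorem vDiff_nonlinCurv (hx : x ∈ O) (hv : v ≠ 0) (X Y : E) :
    vDiff ℓ (x, v) (nonlinCurv ℓ (x, v) Y X) = 0 := by
  have h := hℓ.contDiffAt hx hv
  have h1 : ContDiffAt ℝ ∞ (fderiv ℝ ℓ) (x, v) := h.fderiv_right (by simp)
  have d1 := (h1.differentiableAt (by simp)).hasFDerivAt
  have dN := ((hℓ.contDiffAt_nonlinConn hx hv).differentiableAt (by simp)).hasFDerivAt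
  -- Differentiating ∂ℓ/∂v (N Y) = ∂ℓ/∂x (Y) along the horizontal lift of X leaves the second
  -- derivative of ℓ on the horizontal lifts of X and Y. It is symmetric, so it disappears from the
  -- curvature, which is the antisymmetrization.
  have key : ∀ X Y : E, vDiff ℓ (x, v) (hLiftN ℓ (x, v) X Y) =
      fderiv ℝ (fderiv ℝ ℓ) (x, v) (X, -nonlinConn ℓ (x, v) X) (Y, -nonlinConn ℓ (x, v) Y) := by
    intro X Y
    have hi : HasFDerivAt (fun z : E × E => ((0 : E), nonlinConn ℓ z Y)) _ (x, v) :=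
      (hasFDerivAt_const (0 : E) (x, v)).prodMk (dN.clm_apply (hasFDerivAt_const Y (x, v)))
    have e1 : HasFDerivAt (fun z : E × E => fderiv ℝ ℓ z (0, nonlinConn ℓ z Y)) _ (x, v) :=
      d1.clm_apply hi
    have e2 : HasFDerivAt (fun z : E × E => fderiv ℝ ℓ z (Y, 0)) _ (x, v) :=
      d1.clm_apply (hasFDerivAt_const (Y, (0 : E)) (x, v))
    have he : (fun z : E × E => fderiv ℝ ℓ z (0, nonlinConn ℓ z Y)) =ᶠ[𝓝 (x, v)]
        fun z : E × E => fderiv ℝ ℓ z (Y, 0) := by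
      filter_upwards [hℓ.mem_nhds hx hv] with z hz
      exact hℓ.hDiff_eq hz.1 hz.2 Y
    have := congrArg (fun A => A (X, -nonlinConn ℓ (x, v) X))
      ((e1.congr_of_eventuallyEq he.symm).unique e2)
    simp at this
    have hl : hLiftN ℓ (x, v) X Y =
        fderiv ℝ (nonlinConn ℓ) (x, v) (X, -nonlinConn ℓ (x, v) X) Y := by
      have hsplit : (X, -nonlinConn ℓ (x, v) X) = (X, 0) - ((0 : E), nonlinConn ℓ (x, v) X) := by
        simp
      rw [hsplit, map_sub]
      simp [hLiftN, hDiff_apply, vDiff_apply]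
    have hsplit : (Y, -nonlinConn ℓ (x, v) Y) = (Y, 0) - ((0 : E), nonlinConn ℓ (x, v) Y) := by
      simp
    rw [hsplit, map_sub, hl, vDiff_apply]
    linarith
  have : nonlinCurv ℓ (x, v) Y X = hLiftN ℓ (x, v) X Y - hLiftN ℓ (x, v) Y X := by
    simp [nonlinCurv]
  rw [this, map_sub, key, key, hℓ.second_comm hx hv, sub_self]

end IsLocalFinsler

end LocalFinsler

/-! ### Linear algebra of Lorentzian forms and traces. -/

section LinearAlgebra

variable {E : Type*} [NormedAddCommGroup E] [NormedSpace ℝ E]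

/-- A linear form vanishing on the kernel of g(n, ·) is a multiple of it, and nondegeneracy carries
the factor over to the vectors. This turns proportionality to n into orthogonality to the
hypersurface. -/
theorem IsLorentzian.mem_span {g : E →L[ℝ] E →L[ℝ] ℝ} (hg : IsLorentzian g) {n W : E} (hn : n ≠ 0)
    (h : ∀ Z, g n Z = 0 → g W Z = 0) : W ∈ Submodule.span ℝ {n} := by
  obtain ⟨e, he⟩ : ∃ e, g n e ≠ 0 := by
    by_contra! hc
    exact hn (hg.eq_zero hc)
  refine Submodule.mem_span_singleton.2 ⟨g W e / g n e, (hg.ext_left fun Z => ?_).symm⟩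
  have := h (Z - (g n Z / g n e) • e) (by simp [he])
  simp only [map_sub, map_smul, smul_eq_mul, smul_apply] at this ⊢
  rw [sub_eq_zero.1 this]
  field_simp

/-- The trace of an endomorphism with values in a hyperplane containing `n`, equal on that hyperplane
to `X ↦ β X • n`. -/
theorem trace_eq_of_hyperplane [FiniteDimensional ℝ E] {A : E →ₗ[ℝ] E} {α β : E →ₗ[ℝ] ℝ} {n : E}
    (hα : α ≠ 0) (hn : α n = 0) (hA : ∀ X, α (A X) = 0) (hβ : ∀ X, α X = 0 → A X = β X • n) :
    LinearMap.trace ℝ E A = β n := by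
  obtain ⟨e, he⟩ : ∃ e, α e ≠ 0 := by
    by_contra! hc
    exact hα (LinearMap.ext hc)
  -- Splitting X into a part in ker α and a multiple of e writes A as a sum of two rank-one maps.
  -- Their traces are β n, because α n = 0, and α (A e) / α e = 0.
  have hdec : A = (β - (β e / α e) • α).smulRight n + ((α e)⁻¹ • α).smulRight (A e) := by
    ext X
    have h := hβ (X - (α X / α e) • e) (by simp [he])
    simp only [map_sub, map_smul, smul_eq_mul, sub_eq_iff_eq_add] at h
    simp only [LinearMap.add_apply, LinearMap.smulRight_apply, LinearMap.sub_apply,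
      LinearMap.smul_apply, smul_eq_mul]
    rw [h]
    congr 2 <;> ring
  rw [hdec, map_add, LinearMap.trace_smulRight, LinearMap.trace_smulRight]
  simp [hn, hA]

/-- Matches the degree-two homogeneity of the spray, for velocities that are multiples of n. -/
theorem christoffel_smul (h : E → E →L[ℝ] E →L[ℝ] ℝ) (x X Y : E) (a b : ℝ) :
    christoffel h x (a • X) (b • Y) = (a * b) • christoffel h x X Y := by
  rw [christoffel, christoffel, ← map_smul]
  congr 1
  ext Z
  simp
  ring

end LinearAlgebra

/-! ### The Levi-Civita connection in coordinates and its transformation law. -/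

section Christoffel

variable {E : Type*} [NormedAddCommGroup E] [NormedSpace ℝ E] [FiniteDimensional ℝ E]

theorem metric_christoffel {h : E → E →L[ℝ] E →L[ℝ] ℝ} {x : E} (hx : IsLorentzian (h x))
    (X Y Z : E) : 2 * h x (christoffel h x X Y) Z =
      fderiv ℝ h x X Y Z + fderiv ℝ h x Y X Z - fderiv ℝ h x Z X Y := by
  rw [christoffel, hx.apply_inverse]
  simp

/-- The Levi-Civita covariant derivative of a vector field in coordinates is compatible with the
metric. -/
theorem fderiv_metric_apply_apply {h : E → E →L[ℝ] E →L[ℝ] ℝ} {x : E}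
    (hd : DifferentiableAt ℝ h x) (hs : ∀ᶠ y in 𝓝 x, IsLorentzian (h y)) {Y Z : E → E}
    (hY : DifferentiableAt ℝ Y x) (hZ : DifferentiableAt ℝ Z x) (X : E) :
    fderiv ℝ (fun y => h y (Y y) (Z y)) x X =
      h x (fderiv ℝ Y x X + christoffel h x X (Y x)) (Z x) +
      h x (Y x) (fderiv ℝ Z x X + christoffel h x X (Z x)) := by
  have h1 : HasFDerivAt (fun y => h y (Y y) (Z y)) _ x :=
    (hd.hasFDerivAt.clm_apply hY.hasFDerivAt).clm_apply hZ.hasFDerivAt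
  have hsymm : ∀ a b c, fderiv ℝ h x a b c = fderiv ℝ h x a c b := by
    intro a b c
    have he : (fun y => h y b c) =ᶠ[𝓝 x] fun y => h y c b := by
      filter_upwards [hs] with y hy
      exact hy.1 b c
    rw [← fderiv_apply_apply hd, ← fderiv_apply_apply hd, he.fderiv_eq]
  have hx := hs.self_of_nhds
  have c1 := metric_christoffel hx X (Y x) (Z x)
  have c2 := metric_christoffel hx X (Z x) (Y x)
  rw [h1.fderiv, hx.1 (Y x), map_add, map_add]
  simp
  rw [hx.1 (fderiv ℝ Z x X)]
  rw [hsymm X (Z x) (Y x)] at c2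
  linarith

/-- The transformation law of Levi-Civita covariant derivatives under a change of coordinates
`ψ`. -/
theorem covariantDeriv_coordChange {h h' : E → E →L[ℝ] E →L[ℝ] ℝ} {ψ : E → E} {Y Y' : E → E} {x : E}
    (hψ : ContDiffAt ℝ 2 ψ x) (hsurj : Function.Surjective (fderiv ℝ ψ x))
    (hh : ∀ᶠ y in 𝓝 x, ∀ a b, h y a b = h' (ψ y) (fderiv ℝ ψ y a) (fderiv ℝ ψ y b))
    (hd : DifferentiableAt ℝ h x) (hd' : DifferentiableAt ℝ h' (ψ x))
    (hl : IsLorentzian (h x)) (hl' : IsLorentzian (h' (ψ x)))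
    (hY : DifferentiableAt ℝ Y x) (hY' : DifferentiableAt ℝ Y' (ψ x))
    (hYY : ∀ᶠ y in 𝓝 x, Y' (ψ y) = fderiv ℝ ψ y (Y y)) (X : E) :
    fderiv ℝ ψ x (fderiv ℝ Y x X + christoffel h x X (Y x)) =
      fderiv ℝ Y' (ψ x) (fderiv ℝ ψ x X) +
        christoffel h' (ψ x) (fderiv ℝ ψ x X) (Y' (ψ x)) := by
  have d1 := (hψ.differentiableAt (by simp)).hasFDerivAt
  have d2 := ((hψ.fderiv_right (m := 1) (by norm_num)).differentiableAt (by simp)).hasFDerivAt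
  set ψ' := fderiv ℝ ψ x
  set ψ'' := fderiv ℝ (fderiv ℝ ψ) x
  have hsymm : ∀ a b, ψ'' a b = ψ'' b a := fun a b => hψ.isSymmSndFDerivAt (by simp) a b
  have hYd : fderiv ℝ Y' (ψ x) (ψ' X) = ψ'' X (Y x) + ψ' (fderiv ℝ Y x X) := by
    have e1 : HasFDerivAt (fun y => Y' (ψ y)) _ x := hY'.hasFDerivAt.comp x d1
    have e2 : HasFDerivAt (fun y => fderiv ℝ ψ y (Y y)) _ x := d2.clm_apply hY.hasFDerivAt
    have := congrArg (fun A => A X) ((e1.congr_of_eventuallyEq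
      (hYY.mono fun y hy => hy.symm)).unique e2)
    simpa [add_comm] using this
  have hhd : ∀ X a b, fderiv ℝ h x X a b = fderiv ℝ h' (ψ x) (ψ' X) (ψ' a) (ψ' b) +
      h' (ψ x) (ψ'' X a) (ψ' b) + h' (ψ x) (ψ' a) (ψ'' X b) := by
    intro X a b
    have e1 : HasFDerivAt (fun y => h' (ψ y) (fderiv ℝ ψ y a) (fderiv ℝ ψ y b)) _ x :=
      ((hd'.hasFDerivAt.comp x d1).clm_apply (d2.clm_apply (hasFDerivAt_const a x))).clm_apply
        (d2.clm_apply (hasFDerivAt_const b x))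
    have he : (fun y => h y a b) =ᶠ[𝓝 x]
        fun y => h' (ψ y) (fderiv ℝ ψ y a) (fderiv ℝ ψ y b) := hh.mono fun y hy => hy a b
    rw [← fderiv_apply_apply hd, he.fderiv_eq, e1.fderiv]
    simp [ψ', ψ'']
    ring
  -- In the Koszul combination the terms with ψ'' cancel by symmetry, except for 2 h'(ψ''(X, Y), ψ'
  -- Z); testing against vectors ψ' Z suffices as ψ' is onto. The resulting inhomogeneous term is
  -- the one that `hYd` produces for ∂Y'.
  have hΓ : ψ' (christoffel h x X (Y x)) =
      ψ'' X (Y x) + christoffel h' (ψ x) (ψ' X) (ψ' (Y x)) := by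
    refine hl'.ext_left fun W => ?_
    obtain ⟨Z, rfl⟩ := hsurj W
    have c1 := metric_christoffel hl X (Y x) Z
    have c2 := metric_christoffel hl' (ψ' X) (ψ' (Y x)) (ψ' Z)
    rw [hh.self_of_nhds, hhd, hhd, hhd, hsymm (Y x) X, hsymm Z, hsymm Z,
      hl'.1 (ψ' X) (ψ'' (Y x) Z), hl'.1 (ψ' (Y x))] at c1
    rw [map_add, add_apply]
    change _ = h' (ψ x) _ (ψ' Z) + _
    linarith
  rw [map_add, hΓ, hYd, hYY.self_of_nhds]
  abel

end Christoffel

/-! ### Null hypersurfaces in a chart: closed conormal, pregeodesic generators, equality of the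
connections. -/

section NullHypersurface

variable {E : Type*} [NormedAddCommGroup E] [NormedSpace ℝ E]

/-- The vectors at `x` annihilated by the differentials of the `C^1` functions vanishing on `H`
near `x`. -/
def localTangent (H : Set E) (x : E) : Set E :=
  {X | ∀ F : E → ℝ, ContDiffAt ℝ 1 F x → (∀ᶠ y in 𝓝[H] x, F y = 0) → fderiv ℝ F x X = 0}

/-- In coordinates and near the point `x`, `H` is a `C^2` null hypersurface with lightlike tangent
field `n`. -/
structure IsLocalNull (ℓ : E × E → ℝ) (H : Set E) (n : E → E) (x : E) : Prop where
  mem : x ∈ H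
  contDiffAt : ContDiffAt ℝ 1 n x
  ne_zero : n x ≠ 0
  tangent : ∀ᶠ y in 𝓝[H] x, ∀ X, X ∈ localTangent H y ↔ vDiff ℓ (y, n y) X = 0
  null : ∀ᶠ y in 𝓝[H] x, vDiff ℓ (y, n y) (n y) = 0
  regular : ∃ f : E → ℝ, ContDiffAt ℝ 2 f x ∧ fderiv ℝ f x ≠ 0 ∧ ∀ᶠ y in 𝓝 x, (y ∈ H ↔ f y = 0)

variable {ℓ : E × E → ℝ} {O H : Set E} {n : E → E} {x : E}

namespace IsLocalNull

theorem mem_localTangent (hN : IsLocalNull ℓ H n x) {X : E} :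
    X ∈ localTangent H x ↔ vDiff ℓ (x, n x) X = 0 :=
  hN.tangent.self_of_nhdsWithin hN.mem X

theorem contDiffAt_pair (hN : IsLocalNull ℓ H n x) : ContDiffAt ℝ 1 (fun y => (y, n y)) x :=
  contDiffAt_id.prodMk hN.contDiffAt

theorem hasFDerivAt_pair (hN : IsLocalNull ℓ H n x) :
    HasFDerivAt (fun y => (y, n y)) ((ContinuousLinearMap.id ℝ E).prod (fderiv ℝ n x)) x :=
  (hasFDerivAt_id x).prodMk (hN.contDiffAt.differentiableAt (by simp)).hasFDerivAt

variable (hℓ : IsLocalFinsler ℓ O) (hN : IsLocalNull ℓ H n x) (hx : x ∈ O)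
include hℓ hN hx

theorem contDiffAt_conormal : ContDiffAt ℝ 1 (fun y => vDiff ℓ (y, n y)) x :=
  ContDiffAt.comp (g := vDiff ℓ) x
    ((contDiffAt_vDiff (hℓ.contDiffAt hx hN.ne_zero)).of_le ENat.LEInfty.out) hN.contDiffAt_pair

theorem contDiffAt_metric : ContDiffAt ℝ 1 (fun y => vDiff (vDiff ℓ) (y, n y)) x :=
  ContDiffAt.comp (g := vDiff (vDiff ℓ)) x
    ((hℓ.contDiffAt_metric hx hN.ne_zero).of_le ENat.LEInfty.out) hN.contDiffAt_pair

theorem eventually_lorentzian :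
    ∀ᶠ y in 𝓝 x, IsLorentzian (vDiff (vDiff ℓ) (y, n y)) := by
  filter_upwards [hℓ.isOpen.mem_nhds hx, hN.contDiffAt.continuousAt.eventually_ne hN.ne_zero]
    with y hy hny using hℓ.lorentzian y hy _ hny

theorem fderiv_conormal (X Z : E) : fderiv ℝ (fun y => vDiff ℓ (y, n y)) x X Z =
    fderiv ℝ (fderiv ℝ ℓ) (x, n x) (X, fderiv ℝ n x X) (0, Z) := by
  have h := hℓ.contDiffAt hx hN.ne_zero
  have h1 : HasFDerivAt (fun y => vDiff ℓ (y, n y)) _ x :=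
    HasFDerivAt.comp x (g := vDiff ℓ)
      ((contDiffAt_vDiff h).differentiableAt (by simp)).hasFDerivAt (hN.hasFDerivAt_pair)
  rw [h1.fderiv]
  simp [fderiv_vDiff_apply h]

theorem fderiv_metric (X a b : E) : fderiv ℝ (fun y => vDiff (vDiff ℓ) (y, n y)) x X a b =
    fderiv ℝ (fderiv ℝ (fderiv ℝ ℓ)) (x, n x) (X, fderiv ℝ n x X) (0, a) (0, b) := by
  have h1 : HasFDerivAt (fun y => vDiff (vDiff ℓ) (y, n y)) _ x :=
    HasFDerivAt.comp x (g := vDiff (vDiff ℓ))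
      ((hℓ.contDiffAt_metric hx hN.ne_zero).differentiableAt (by simp)).hasFDerivAt
      (hN.hasFDerivAt_pair)
  rw [h1.fderiv]
  simp [hℓ.fderiv_metric_apply hx hN.ne_zero]

theorem conormal_ne_zero : vDiff ℓ (x, n x) ≠ 0 := by
  rw [← hℓ.metric_self hx hN.ne_zero]
  intro h
  exact hN.ne_zero ((hℓ.lorentzian x hx _ hN.ne_zero).eq_zero fun Y => by rw [h]; rfl)

/-- The conormal `1`-form is closed on the hypersurface. -/
theorem fderiv_conormal_comm {Y Z : E} (hY : vDiff ℓ (x, n x) Y = 0)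
    (hZ : vDiff ℓ (x, n x) Z = 0) :
    fderiv ℝ (fun y => vDiff ℓ (y, n y)) x Y Z = fderiv ℝ (fun y => vDiff ℓ (y, n y)) x Z Y := by
  obtain ⟨f, hf, hf0, hfH⟩ := hN.regular
  obtain ⟨e, he⟩ : ∃ e, vDiff ℓ (x, n x) e ≠ 0 := by
    by_contra! hc
    exact hN.conormal_ne_zero hℓ hx (ContinuousLinearMap.ext hc)
  have hf1 : ContDiffAt ℝ 1 (fderiv ℝ f) x := hf.fderiv_right (by norm_num)
  have hα := hN.contDiffAt_conormal hℓ hx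
  -- on the hypersurface the kernel of the conormal is contained in that of `df`
  have hker : ∀ᶠ y in 𝓝[H] x, ∀ X, vDiff ℓ (y, n y) X = 0 → fderiv ℝ f y X = 0 := by
    filter_upwards [hN.tangent, nhdsWithin_le_nhds (hf.eventually (by simp)),
      nhdsWithin_le_nhds hfH.eventually_nhds] with y hy hfy hyH X hX
    refine (hy X).2 hX f (hfy.of_le (by norm_num)) ?_
    filter_upwards [nhdsWithin_le_nhds hyH, self_mem_nhdsWithin] with w hw hwH using hw.1 hwH
  have hker' := hker.self_of_nhdsWithin hN.mem
  have hde : fderiv ℝ f x e ≠ 0 := by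
    intro h0
    apply hf0
    ext X
    have := hker' (X - (vDiff ℓ (x, n x) X / vDiff ℓ (x, n x) e) • e) (by simp [he])
    simpa [h0] using this
  -- Let α be the conormal. The function df(Z) α(e) - df(e) α(Z) vanishes on `H`, since α(e) Z -
  -- α(Z) e lies in ker α ⊆ ker df. Its derivative along the tangent vector Y expresses the
  -- derivative of α through the Hessian of f, which is symmetric; the remaining terms contain df(Z)
  -- or α(Z), both zero at x.
  have key : ∀ Y Z, vDiff ℓ (x, n x) Y = 0 → vDiff ℓ (x, n x) Z = 0 →
      fderiv ℝ (fderiv ℝ f) x Y Z * vDiff ℓ (x, n x) e =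
        fderiv ℝ f x e * fderiv ℝ (fun y => vDiff ℓ (y, n y)) x Y Z := by
    intro Y Z hY hZ
    have hF : ContDiffAt ℝ 1 (fun y => fderiv ℝ f y Z * vDiff ℓ (y, n y) e -
        fderiv ℝ f y e * vDiff ℓ (y, n y) Z) x :=
      ((hf1.clm_apply contDiffAt_const).mul (hα.clm_apply contDiffAt_const)).sub
        ((hf1.clm_apply contDiffAt_const).mul (hα.clm_apply contDiffAt_const))
    have hF0 := hN.mem_localTangent.2 hY _ hF (by
      filter_upwards [hker] with y hy
      have := hy (vDiff ℓ (y, n y) e • Z - vDiff ℓ (y, n y) Z • e) (by simp [mul_comm])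
      simp only [map_sub, map_smul, smul_eq_mul] at this
      linarith)
    have d1 := (hf1.differentiableAt (by simp)).hasFDerivAt
    have d2 := (hα.differentiableAt (by simp)).hasFDerivAt
    have dF := ((d1.clm_apply (hasFDerivAt_const Z x)).mul
      (d2.clm_apply (hasFDerivAt_const e x))).sub
      ((d1.clm_apply (hasFDerivAt_const e x)).mul (d2.clm_apply (hasFDerivAt_const Z x)))
    erw [dF.fderiv] at hF0
    simp [hker' Z hZ, hZ] at hF0
    linarith
  have h1 := key Y Z hY hZ
  rw [hf.isSymmSndFDerivAt (by simp) Y Z, key Z Y hZ hY] at h1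
  exact (mul_left_cancel₀ hde h1).symm

variable [FiniteDimensional ℝ E]

/-- The generators of a null hypersurface are pregeodesics. -/
theorem covariantDeriv_self_mem_span :
    fderiv ℝ n x (n x) + nonlinConn ℓ (x, n x) (n x) ∈ Submodule.span ℝ {n x} := by
  have hne := hN.ne_zero
  refine (hℓ.lorentzian x hx _ hne).mem_span hne fun Z hZ => ?_
  rw [hℓ.metric_self hx hne] at hZ
  have h := hℓ.contDiffAt hx hne
  have hnn := hN.null.self_of_nhdsWithin hN.mem
  have hα := hN.contDiffAt_conormal hℓ hx
  have dn := (hN.contDiffAt.differentiableAt (by simp)).hasFDerivAt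
  have hTZ := hN.mem_localTangent.2 hZ
  -- Both ℓ(y, n y) and the conormal applied to n vanish only on `H`, so they are differentiated in
  -- the tangent direction Z alone, here and in `e2`.
  have e1 : fderiv ℝ ℓ (x, n x) (Z, fderiv ℝ n x Z) = 0 := by
    have hc : ContDiffAt ℝ 1 (fun y => ℓ (y, n y)) x :=
      (h.of_le ENat.LEInfty.out).comp x (hN.contDiffAt_pair)
    have := hTZ _ hc (by
      filter_upwards [hN.null, nhdsWithin_le_nhds (hℓ.isOpen.mem_nhds hx),
        nhdsWithin_le_nhds (hN.contDiffAt.continuousAt.eventually_ne hne)] with y hy hyO hyn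
      rw [hℓ.vDiff_self hyO hyn] at hy
      linarith)
    have hd : HasFDerivAt (fun y => ℓ (y, n y)) _ x :=
      HasFDerivAt.comp x (g := ℓ) (h.differentiableAt (by simp)).hasFDerivAt
        (hN.hasFDerivAt_pair)
    rw [hd.fderiv] at this
    simpa using this
  have e2 : fderiv ℝ (fun y => vDiff ℓ (y, n y)) x Z (n x) +
      vDiff ℓ (x, n x) (fderiv ℝ n x Z) = 0 := by
    have := hTZ _ (hα.clm_apply hN.contDiffAt) hN.null
    rw [((hα.differentiableAt (by simp)).hasFDerivAt.clm_apply dn).fderiv] at this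
    simpa [add_comm] using this
  -- With α the conormal, closedness trades (∂_n α)(Z) for (∂_Z α)(n), which equals ∂ℓ/∂x (Z) by
  -- `e1` and `e2`. Expanding the former and using the spray equation leaves g_n(∂_n n + 2G, Z) = 0.
  have e3 := hN.fderiv_conormal_comm hℓ hx hnn hZ
  have e4 := congrArg (fun A => A Z) (hℓ.spray_eq hx hne)
  have hs1 : (Z, fderiv ℝ n x Z) = (Z, 0) + ((0 : E), fderiv ℝ n x Z) := by simp
  have hs2 : (n x, fderiv ℝ n x (n x)) = (n x, 0) + ((0 : E), fderiv ℝ n x (n x)) := by simp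
  rw [hN.fderiv_conormal hℓ hx, hs2, map_add, add_apply, ← hℓ.metric_apply hx hne] at e3
  rw [hs1, map_add, ← vDiff_apply] at e1
  rw [hℓ.nonlinConn_self hx hne]
  simp [hDiff_apply, fderiv_vDiff_apply h] at e4 ⊢
  linarith

/-- Along a null hypersurface, the non-linear connection and the Levi-Civita connection of `g_n`
agree on `n`. -/
theorem nonlinConn_eq_christoffel (X : E) : nonlinConn ℓ (x, n x) X =
    christoffel (fun y => vDiff (vDiff ℓ) (y, n y)) x X (n x) := by
  have hne := hN.ne_zero
  -- With ∂_n n = κ n - 2G, the one surviving chain-rule term C(∂_n n, X, Z) of the Koszul formula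
  -- becomes the Cartan term -2 C(G, X, Z) of `metric_nonlinConn`.
  obtain ⟨κ, hκ⟩ := Submodule.mem_span_singleton.1 (hN.covariantDeriv_self_mem_span hℓ hx)
  refine (hℓ.lorentzian x hx _ hne).ext_left fun Z => ?_
  have h1 := hℓ.metric_nonlinConn hx hne X Z
  have h2 := metric_christoffel (h := fun y => vDiff (vDiff ℓ) (y, n y))
    (hℓ.lorentzian x hx _ hne) X (n x) Z
  have hs : ∀ a b : E, (a, b) = (a, 0) + ((0 : E), b) := fun a b => by simp
  have hnn : fderiv ℝ n x (n x) = κ • n x - (2 : ℝ) • spray ℓ (x, n x) := by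
    rw [hκ, hℓ.nonlinConn_self hx hne, add_sub_cancel_right]
  have hs3 : ((0 : E), κ • n x - (2 : ℝ) • spray ℓ (x, n x)) =
      κ • ((0 : E), n x) - (2 : ℝ) • ((0 : E), spray ℓ (x, n x)) := by simp
  have c0 : ∀ a b, fderiv ℝ (fderiv ℝ (fderiv ℝ ℓ)) (x, n x) (0, a) (0, n x) (0, b) = 0 :=
    fun a b => by rw [hℓ.third_comm hx hne, hℓ.cartan_self hx hne]
  have c1 : ∀ a b, fderiv ℝ (fderiv ℝ (fderiv ℝ ℓ)) (x, n x) (0, a) (0, b) (0, n x) = 0 :=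
    fun a b => by rw [hℓ.third_comm_last hx hne, c0]
  rw [hN.fderiv_metric hℓ hx, hN.fderiv_metric hℓ hx, hN.fderiv_metric hℓ hx, hs X, hs (n x),
    hs Z, hnn, hs3] at h2
  simp only [map_add, map_sub, map_smul, add_apply, sub_apply, smul_apply, smul_eq_mul,
    hℓ.third_hDiff_self hx hne, hℓ.cartan_self hx hne, c0, c1,
    hℓ.third_comm_last hx hne (Z, 0) (0, X)] at h2
  linarith

end IsLocalNull

end NullHypersurface

/-! ### Straightening a regular level set. -/

section Straightening

/-- A function with non-zero differential is linear in suitable local coordinates. -/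
theorem exists_straightening {F : Type*} [NormedAddCommGroup F] [NormedSpace ℝ F] [CompleteSpace F]
    {f : F → ℝ} {z₀ : F} {k : WithTop ℕ∞} (hk : k ≠ 0) (hf : ContDiffAt ℝ k f z₀) (h0 : f z₀ = 0)
    (hd : fderiv ℝ f z₀ ≠ 0) :
    ∃ Ψ : OpenPartialHomeomorph F F, z₀ ∈ Ψ.source ∧ Ψ z₀ = 0 ∧ ContDiffAt ℝ k Ψ.symm 0 ∧
      HasFDerivAt Ψ.symm (ContinuousLinearMap.id ℝ F) 0 ∧ ∀ z, fderiv ℝ f z₀ (Ψ z) = f z := by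
  obtain ⟨e, he⟩ : ∃ e, fderiv ℝ f z₀ e = 1 := by
    obtain ⟨e, he⟩ : ∃ e, fderiv ℝ f z₀ e ≠ 0 := by
      by_contra! hc
      exact hd (ContinuousLinearMap.ext hc)
    exact ⟨(fderiv ℝ f z₀ e)⁻¹ • e, by simp [he]⟩
  -- The correction along e vanishes to first order at z₀, so the derivative there is the identity;
  -- the normalization df(e) = 1 makes df ∘ ψ = f exact.
  let ψ : F → F := fun z => (z - z₀) + (f z - fderiv ℝ f z₀ (z - z₀)) • e
  have hψ : ContDiffAt ℝ k ψ z₀ := by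
    have h1 : ContDiffAt ℝ k (fun z : F => z - z₀) z₀ := contDiffAt_id.sub contDiffAt_const
    exact h1.add ((hf.sub ((fderiv ℝ f z₀).contDiff.contDiffAt.comp z₀ h1)).smul contDiffAt_const)
  have hψ' : HasFDerivAt ψ ((ContinuousLinearEquiv.refl ℝ F : F ≃L[ℝ] F) : F →L[ℝ] F) z₀ := by
    have h1 : HasFDerivAt (fun z : F => z - z₀) (ContinuousLinearMap.id ℝ F) z₀ :=
      (hasFDerivAt_id z₀).sub_const z₀
    have h2 := (hf.differentiableAt hk).hasFDerivAt
    have h3 : HasFDerivAt (fun z : F => fderiv ℝ f z₀ (z - z₀)) _ z₀ :=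
      (fderiv ℝ f z₀).hasFDerivAt.comp z₀ h1
    have h4 := h1.add ((h2.sub h3).smul_const e)
    refine h4.congr_fderiv ?_
    ext w
    simp
  let Ψ := hψ.toOpenPartialHomeomorph ψ hψ' hk
  have hΨ : ∀ z, Ψ z = ψ z := fun z => rfl
  have hz : z₀ ∈ Ψ.source := hψ.mem_toOpenPartialHomeomorph_source hψ' hk
  have hΨ0 : Ψ z₀ = 0 := by simp [hΨ, ψ, h0]
  have hs : Ψ.symm 0 = z₀ := by rw [← hΨ0, Ψ.left_inv hz]
  have ht : (0 : F) ∈ Ψ.target := hΨ0 ▸ Ψ.map_source hz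
  refine ⟨Ψ, hz, hΨ0, ?_, ?_, fun z => ?_⟩
  · exact Ψ.contDiffAt_symm (f₀' := ContinuousLinearEquiv.refl ℝ F) ht
      (by rw [hs]; exact hψ') (by rw [hs]; exact hψ)
  · exact Ψ.hasFDerivAt_symm (f' := ContinuousLinearEquiv.refl ℝ F) ht (by rw [hs]; exact hψ')
  · simp [hΨ, ψ, he]

end Straightening

/-! ### Curvature and Ricci form along a null hypersurface with D n = θ ⊗ n. -/

section Curvature

variable {E : Type*} [NormedAddCommGroup E] [NormedSpace ℝ E] [FiniteDimensional ℝ E]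
  {ℓ : E × E → ℝ} {O H : Set E} {n : E → E} {x : E}

namespace IsLocalNull

/-- A `C^2` null hypersurface is locally parametrized by a linear space `K`. -/
theorem exists_parametrization (hN : IsLocalNull ℓ H n x) :
    ∃ (K : Submodule ℝ E) (φ : K → E), φ 0 = x ∧ ContDiffAt ℝ 2 φ 0 ∧
      fderiv ℝ φ 0 = K.subtypeL ∧ (∀ᶠ y in 𝓝 (0 : K), φ y ∈ H) ∧
      ∀ X, vDiff ℓ (x, n x) X = 0 → X ∈ K := by
  obtain ⟨f, hf, hf0, hfH⟩ := hN.regular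
  have hfx : f x = 0 := hfH.self_of_nhds.1 hN.mem
  obtain ⟨Ψ, hx, hΨ, hc, hd, hfΨ⟩ := exists_straightening (by simp) hf hfx hf0
  have hs : Ψ.symm 0 = x := by rw [← hΨ, Ψ.left_inv hx]
  have ht : (0 : E) ∈ Ψ.target := hΨ ▸ Ψ.map_source hx
  -- Because df ∘ Ψ = f, the hypersurface becomes ker df in the coordinates Ψ; φ is the restriction
  -- of Ψ⁻¹ to it.
  let K : Submodule ℝ E := LinearMap.ker (fderiv ℝ f x : E →ₗ[ℝ] ℝ)
  have hK : ∀ y : K, fderiv ℝ f x y = 0 := fun y => y.2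
  have hsub : ContinuousAt (K.subtypeL) (0 : K) := K.subtypeL.continuous.continuousAt
  have hd' : HasFDerivAt (fun y : K => Ψ.symm (y : E)) (K.subtypeL) 0 :=
    HasFDerivAt.comp (g := Ψ.symm) (f := K.subtypeL) (g' := ContinuousLinearMap.id ℝ E) (0 : K)
      (by simpa using hd) K.subtypeL.hasFDerivAt
  refine ⟨K, fun y => Ψ.symm (y : E), by simpa using hs, ?_, hd'.fderiv, ?_, ?_⟩
  · exact ContDiffAt.comp (g := Ψ.symm) (0 : K) (by simpa using hc)
      K.subtypeL.contDiff.contDiffAt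
  · have h1 : ∀ᶠ y : K in 𝓝 0, (y : E) ∈ Ψ.target :=
      hsub.eventually_mem (Ψ.open_target.mem_nhds (by simpa using ht))
    have h2 : ∀ᶠ y : K in 𝓝 0, Ψ.symm (y : E) ∈ H ↔ f (Ψ.symm (y : E)) = 0 := by
      have : Filter.Tendsto (fun y : K => Ψ.symm (y : E)) (𝓝 0) (𝓝 x) := by
        have := hd'.continuousAt.tendsto
        simpa [hs] using this
      exact this.eventually hfH
    filter_upwards [h1, h2] with y hy1 hy2
    rw [hy2, ← hfΨ, Ψ.right_inv hy1, hK]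
  · intro X hX
    refine LinearMap.mem_ker.2 (hN.mem_localTangent.2 hX f (hf.of_le (by norm_num)) ?_)
    filter_upwards [nhdsWithin_le_nhds hfH, self_mem_nhdsWithin] with w hw hwH using hw.1 hwH

variable (hℓ : IsLocalFinsler ℓ O) (hN : IsLocalNull ℓ H n x) (hx : x ∈ O)
include hℓ hN hx

/-- If `D n = θ ⊗ n` on a null hypersurface, then the curvature of the non-linear connection is
`dθ ⊗ n` there. -/
theorem nonlinCurv_eq {θ : E → E →L[ℝ] ℝ} (hθ : ContDiffAt ℝ 1 θ x)
    (h : ∀ᶠ y in 𝓝[H] x, ∀ X ∈ localTangent H y,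
      fderiv ℝ n y X + nonlinConn ℓ (y, n y) X = θ y X • n y)
    {X Y : E} (hX : vDiff ℓ (x, n x) X = 0) (hY : vDiff ℓ (x, n x) Y = 0) :
    nonlinCurv ℓ (x, n x) Y X = (fderiv ℝ θ x X Y - fderiv ℝ θ x Y X) • n x := by
  have hne := hN.ne_zero
  obtain ⟨K, φ, hφ0, hφ, hφ', hφH, hK⟩ := hN.exists_parametrization
  have hφc : Filter.Tendsto φ (𝓝 0) (𝓝 x) := hφ0 ▸ hφ.continuousAt.tendsto
  have hφ1 : ContDiffAt ℝ 1 (fderiv ℝ φ) 0 := hφ.fderiv_right (by norm_num)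
  have hφ1' : ContDiffAt ℝ 1 φ 0 := hφ.of_le (by norm_num)
  have hnφ : ContDiffAt ℝ 1 (fun y => n (φ y)) 0 :=
    ContDiffAt.comp (g := n) (0 : K) (by rw [hφ0]; exact hN.contDiffAt) hφ1'
  have hθφ : ContDiffAt ℝ 1 (fun y => θ (φ y)) 0 :=
    ContDiffAt.comp (g := θ) (0 : K) (by rw [hφ0]; exact hθ) hφ1'
  have hNφ : ContDiffAt ℝ 1 (fun y => nonlinConn ℓ (φ y, n (φ y))) 0 :=
    ContDiffAt.comp (g := nonlinConn ℓ) (0 : K)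
      (by simpa only [hφ0] using (hℓ.contDiffAt_nonlinConn hx hne).of_le ENat.LEInfty.out)
      (hφ1'.prodMk hnφ)
  -- The right-hand side of ∂n = θ ⊗ n - N, pulled back to K. It contains no derivative of n, so it
  -- is C¹ although n is only C¹. Thus n ∘ φ has a second derivative at 0, whose symmetry is the
  -- integrability condition sought.
  let B : K → K →L[ℝ] E := fun y => ((θ (φ y)).comp (fderiv ℝ φ y)).smulRight (n (φ y)) -
    (nonlinConn ℓ (φ y, n (φ y))).comp (fderiv ℝ φ y)
  have hB : ContDiffAt ℝ 1 B 0 :=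
    ((hθφ.clm_comp hφ1).smulRight hnφ).sub (hNφ.clm_comp hφ1)
  have hBd : DifferentiableAt ℝ B 0 := hB.differentiableAt (by simp)
  -- `n ∘ φ` has derivative `B`
  have hder : ∀ᶠ y in 𝓝 (0 : K), HasFDerivAt (fun y => n (φ y)) (B y) y := by
    have hHc : Filter.Tendsto φ (𝓝 0) (𝓝[H] x) := tendsto_nhdsWithin_iff.2 ⟨hφc, hφH⟩
    filter_upwards [hHc.eventually h, hφ.eventually (by simp), hφH.eventually_nhds,
      hφc.eventually (hN.contDiffAt.eventually (by simp))] with y hy hφy hyH hny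
    have d1 : HasFDerivAt φ (fderiv ℝ φ y) y := (hφy.differentiableAt (by simp)).hasFDerivAt
    have d2 : HasFDerivAt (fun y => n (φ y)) _ y :=
      (hny.differentiableAt (by simp)).hasFDerivAt.comp y d1
    refine d2.congr_fderiv (ContinuousLinearMap.ext fun k => ?_)
    have htan : fderiv ℝ φ y k ∈ localTangent H (φ y) := by
      intro F hF hF0
      have d3 : HasFDerivAt (fun y => F (φ y)) _ y :=
        (hF.differentiableAt (by simp)).hasFDerivAt.comp y d1
      have hcy : Filter.Tendsto φ (𝓝 y) (𝓝[H] (φ y)) :=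
        tendsto_nhdsWithin_iff.2 ⟨d1.continuousAt, hyH⟩
      have d4 : (fun y => F (φ y)) =ᶠ[𝓝 y] fun _ => (0 : ℝ) := hcy.eventually hF0
      have := d3.fderiv
      rw [d4.fderiv_eq, fderiv_fun_const] at this
      simpa using (congrArg (fun A => A k) this).symm
    have := hy _ htan
    simp [B, ← this]
  have hBsymm := fun a b => second_derivative_symmetric_of_eventually hder hBd.hasFDerivAt a b
  have hφsymm : ∀ a b, fderiv ℝ (fderiv ℝ φ) 0 a b = fderiv ℝ (fderiv ℝ φ) 0 b a := fun a b =>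
    hφ.isSymmSndFDerivAt (by simp) a b
  have hn' : ∀ a : K, fderiv ℝ n x a = θ x a • n x - nonlinConn ℓ (x, n x) a := by
    intro a
    have d1 : HasFDerivAt (fun y => n (φ y)) ((fderiv ℝ n x).comp (fderiv ℝ φ 0)) 0 :=
      HasFDerivAt.comp (g := n) (0 : K)
        (by rw [hφ0]; exact (hN.contDiffAt.differentiableAt (by simp)).hasFDerivAt)
        (hφ.differentiableAt (by simp)).hasFDerivAt
    have := congrArg (fun A => A a) (d1.unique hder.self_of_nhds)
    simpa [B, hφ', hφ0] using this
  have hφd : HasFDerivAt φ K.subtypeL 0 := hφ' ▸ (hφ.differentiableAt (by simp)).hasFDerivAt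
  have hnφd : HasFDerivAt (fun y => n (φ y)) ((fderiv ℝ n x).comp K.subtypeL) 0 :=
    HasFDerivAt.comp (g := n) (0 : K)
      (by rw [hφ0]; exact (hN.contDiffAt.differentiableAt (by simp)).hasFDerivAt) hφd
  have hθφd : HasFDerivAt (fun y => θ (φ y)) ((fderiv ℝ θ x).comp K.subtypeL) 0 :=
    HasFDerivAt.comp (g := θ) (0 : K)
      (by rw [hφ0]; exact (hθ.differentiableAt (by simp)).hasFDerivAt) hφd
  have hNφd : HasFDerivAt (fun y => nonlinConn ℓ (φ y, n (φ y)))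
      ((fderiv ℝ (nonlinConn ℓ) (x, n x)).comp
        (K.subtypeL.prod ((fderiv ℝ n x).comp K.subtypeL))) 0 :=
    HasFDerivAt.comp (g := nonlinConn ℓ) (0 : K)
      (by simpa only [hφ0] using
        ((hℓ.contDiffAt_nonlinConn hx hne).differentiableAt (by simp)).hasFDerivAt)
      (hφd.prodMk hnφd)
  have hφdd := (hφ1.differentiableAt (by simp)).hasFDerivAt
  have hB' : ∀ a b : K, fderiv ℝ B 0 a b =
      (fderiv ℝ θ x a b + θ x (fderiv ℝ (fderiv ℝ φ) 0 a b)) • n x + θ x b • fderiv ℝ n x a -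
      (fderiv ℝ (nonlinConn ℓ) (x, n x) (a, fderiv ℝ n x a) b +
        nonlinConn ℓ (x, n x) (fderiv ℝ (fderiv ℝ φ) 0 a b)) := by
    intro a b
    have e1 : HasFDerivAt (fun y => B y b) _ 0 := hBd.hasFDerivAt.clm_apply (hasFDerivAt_const b 0)
    have e2 : HasFDerivAt (fun y => θ (φ y) (fderiv ℝ φ y b) • n (φ y) -
        nonlinConn ℓ (φ y, n (φ y)) (fderiv ℝ φ y b)) _ 0 :=
      ((hθφd.clm_apply (hφdd.clm_apply (hasFDerivAt_const b 0))).smul hnφd).sub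
        (hNφd.clm_apply (hφdd.clm_apply (hasFDerivAt_const b 0)))
    have := congrArg (fun A => A a) (e1.unique e2)
    simp [hφ', hφ0] at this
    rw [this]
    module
  have hlift : ∀ a b : E, hLiftN ℓ (x, n x) a b =
      fderiv ℝ (nonlinConn ℓ) (x, n x) (a, 0) b -
        fderiv ℝ (nonlinConn ℓ) (x, n x) (0, nonlinConn ℓ (x, n x) a) b := by
    intro a b
    simp [hLiftN, hDiff_apply, vDiff_apply]
  have hsplit : ∀ a : K, ∀ b : E, fderiv ℝ (nonlinConn ℓ) (x, n x) (a, fderiv ℝ n x a) b =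
      hLiftN ℓ (x, n x) a b + θ x a • nonlinConn ℓ (x, n x) b := by
    intro a b
    have h1 : ((a : E), fderiv ℝ n x a) =
        ((a : E), 0) + (θ x a • ((0 : E), n x) - ((0 : E), nonlinConn ℓ (x, n x) a)) := by
      rw [hn']; simp
    have h2 : fderiv ℝ (nonlinConn ℓ) (x, n x) (0, n x) = nonlinConn ℓ (x, n x) := by
      rw [← vDiff_apply, hℓ.vDiff_nonlinConn_self hx hne]
    rw [h1, map_add, map_sub, map_smul, h2, hlift]
    simp only [add_apply, sub_apply, smul_apply]
    abel
  -- In the expansion of B' the terms with φ'', the term θ(X) θ(Y) n and the sum θ(X) N Y + θ(Y) N X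
  -- are symmetric and drop out. What remains is dθ(X, Y) n minus the curvature.
  have key := hBsymm ⟨X, hK X hX⟩ ⟨Y, hK Y hY⟩
  rw [hB', hB', hφsymm ⟨Y, _⟩, hsplit, hsplit, hn', hn'] at key
  have hcurv : nonlinCurv ℓ (x, n x) Y X = hLiftN ℓ (x, n x) X Y - hLiftN ℓ (x, n x) Y X := by
    simp [nonlinCurv]
  rw [hcurv, ← sub_eq_zero]
  rw [← sub_eq_zero] at key
  rw [← neg_eq_zero, ← key]
  dsimp only
  module

/-- If `D n = θ ⊗ n` on a null hypersurface, then `Ric_n = i_n dθ` there. -/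
theorem trace_nonlinCurv {θ : E → E →L[ℝ] ℝ} (hθ : ContDiffAt ℝ 1 θ x)
    (h : ∀ᶠ y in 𝓝[H] x, ∀ X ∈ localTangent H y,
      fderiv ℝ n y X + nonlinConn ℓ (y, n y) X = θ y X • n y)
    {Y : E} (hY : vDiff ℓ (x, n x) Y = 0) :
    LinearMap.trace ℝ E (nonlinCurv ℓ (x, n x) Y : E →ₗ[ℝ] E) =
      fderiv ℝ θ x (n x) Y - fderiv ℝ θ x Y (n x) := by
  have h0 : ((vDiff ℓ (x, n x) : E →L[ℝ] ℝ) : E →ₗ[ℝ] ℝ) ≠ 0 := fun hc =>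
    hN.conormal_ne_zero hℓ hx (by ext X; exact congrArg (fun A => A X) hc)
  have := trace_eq_of_hyperplane (A := (nonlinCurv ℓ (x, n x) Y : E →ₗ[ℝ] E))
    (β := (((fderiv ℝ θ x).flip Y - fderiv ℝ θ x Y : E →L[ℝ] ℝ) : E →ₗ[ℝ] ℝ)) (n := n x) h0
    (hN.null.self_of_nhdsWithin hN.mem) (fun X => hℓ.vDiff_nonlinCurv hx hN.ne_zero X Y)
    (fun X hX => by simpa using hN.nonlinCurv_eq hℓ hx hθ h hX hY)
  simpa using this

end IsLocalNull

end Curvature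

/-! ### Subsets of the manifold in a chart. -/

section SetInChart

variable {E : Type*} [NormedAddCommGroup E] {M : Type*} [TopologicalSpace M] [ChartedSpace E M]

/-- A subset of the manifold in the chart around `c`. -/
def setInChart (H : Set M) (c : M) : Set E :=
  (chartAt E c).target ∩ (chartAt E c).symm ⁻¹' H

theorem mem_setInChart {H : Set M} {c q : M} (hq : q ∈ (chartAt E c).source) :
    chartAt E c q ∈ setInChart H c ↔ q ∈ H := by
  simp [setInChart, (chartAt E c).map_source hq, (chartAt E c).left_inv hq]

theorem tendsto_chart_symm {H : Set M} {c q : M} (hq : q ∈ (chartAt E c).source) :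
    Filter.Tendsto (chartAt E c).symm (𝓝[setInChart H c] (chartAt E c q)) (𝓝[H] q) := by
  refine tendsto_nhdsWithin_iff.2 ⟨?_, ?_⟩
  · exact ((chartAt E c).tendsto_symm hq).mono_left nhdsWithin_le_nhds
  · filter_upwards [self_mem_nhdsWithin] with y hy using hy.2

theorem tendsto_chart {H : Set M} {c q : M} (hq : q ∈ (chartAt E c).source) :
    Filter.Tendsto (chartAt E c) (𝓝[H] q) (𝓝[setInChart H c] (chartAt E c q)) := by
  refine tendsto_nhdsWithin_iff.2 ⟨?_, ?_⟩
  · exact ((chartAt E c).continuousAt hq).tendsto.mono_left nhdsWithin_le_nhds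
  · filter_upwards [self_mem_nhdsWithin,
      nhdsWithin_le_nhds ((chartAt E c).open_source.mem_nhds hq)] with y hy hys
    exact (mem_setInChart hys).2 hy

end SetInChart

/-! ### Vectors, functions and tangent spaces in charts. -/

section Charts

variable {E : Type*} [NormedAddCommGroup E] [NormedSpace ℝ E]
  {M : Type*} [TopologicalSpace M] [ChartedSpace E M] [IsManifold 𝓘(ℝ, E) ∞ M]

theorem toCoords_ofCoords {c q : M} (hq : q ∈ (chartAt E c).source) (v : E) :
    toCoords c q (ofCoords c q v) = v :=
  (trivializationAt E (TangentSpace 𝓘(ℝ, E) : M → Type _) c).continuousLinearMapAt_symmL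
    (by simpa using hq) v

theorem ofCoords_toCoords {c q : M} (hq : q ∈ (chartAt E c).source) (v : TangentSpace 𝓘(ℝ, E) q) :
    ofCoords c q (toCoords c q v) = v :=
  (trivializationAt E (TangentSpace 𝓘(ℝ, E) : M → Type _) c).symmL_continuousLinearMapAt
    (by simpa using hq) v

theorem toCoords_eq_coordChange {c q : M} (hq : q ∈ (chartAt E c).source)
    (v : TangentSpace 𝓘(ℝ, E) q) :
    toCoords c q v = tangentCoordChange 𝓘(ℝ, E) q c q v := by
  rw [toCoords, TangentBundle.continuousLinearMapAt_trivializationAt_eq_core hq]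
  rfl

theorem toCoords_self (p : M) (v : TangentSpace 𝓘(ℝ, E) p) : toCoords p p v = v := by
  rw [toCoords_eq_coordChange (mem_chart_source E p)]
  exact tangentCoordChange_self (mem_extChartAt_source p)

theorem ofCoords_self (p : M) (v : E) : ofCoords p p v = v :=
  (congrArg (ofCoords p p) (toCoords_self p v)).symm.trans
    (ofCoords_toCoords (mem_chart_source E p) v)

theorem ofCoords_eq_coordChange {c q : M} (hq : q ∈ (chartAt E c).source) (v : E) :
    ofCoords c q v = tangentCoordChange 𝓘(ℝ, E) c q q v := by
  rw [ofCoords, TangentBundle.symmL_trivializationAt_eq_core hq]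
  rfl

/-- The change of components is the derivative of the change of coordinates. -/
theorem hasFDerivAt_coordChange {c c' q : M} (hq : q ∈ (chartAt E c).source)
    (hq' : q ∈ (chartAt E c').source) :
    HasFDerivAt (chartAt E c' ∘ (chartAt E c).symm)
      ((toCoords c' q).comp (ofCoords c q) : E →L[ℝ] E) (chartAt E c q) := by
  have h := hasFDerivWithinAt_tangentCoordChange (I := 𝓘(ℝ, E)) (x := c) (y := c') (z := q)
    (by simpa using ⟨hq, hq'⟩)
  simp only [mfld_simps, hasFDerivWithinAt_univ] at h
  refine h.congr_fderiv ?_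
  ext v
  have e1 : toCoords c' q (ofCoords c q v) =
      tangentCoordChange 𝓘(ℝ, E) q c' q (tangentCoordChange 𝓘(ℝ, E) c q q v) :=
    (toCoords_eq_coordChange hq' _).trans (congrArg _ (ofCoords_eq_coordChange hq v))
  refine Eq.trans ?_ e1.symm
  exact (tangentCoordChange_comp (by simp [hq, hq'])).symm

theorem contDiffAt_coordChange {c c' q : M} (hq : q ∈ (chartAt E c).source)
    (hq' : q ∈ (chartAt E c').source) :
    ContDiffAt ℝ ∞ (chartAt E c' ∘ (chartAt E c).symm) (chartAt E c q) := by
  have h1 : ContMDiffAt 𝓘(ℝ, E) 𝓘(ℝ, E) ∞ (chartAt E c).symm (chartAt E c q) :=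
    (contMDiffOn_chart_symm (I := 𝓘(ℝ, E))).contMDiffAt
      ((chartAt E c).open_target.mem_nhds ((chartAt E c).map_source hq))
  have h2 : ContMDiffAt 𝓘(ℝ, E) 𝓘(ℝ, E) ∞ (chartAt E c') q :=
    (contMDiffOn_chart (I := 𝓘(ℝ, E))).contMDiffAt ((chartAt E c').open_source.mem_nhds hq')
  exact (ContMDiffAt.comp (chartAt E c q) (by rwa [(chartAt E c).left_inv hq]) h1).contDiffAt

theorem contMDiffAt_real_iff {c q : M} (hq : q ∈ (chartAt E c).source) {f : M → ℝ} {k : ℕ∞} :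
    ContMDiffAt 𝓘(ℝ, E) 𝓘(ℝ, ℝ) k f q ↔
      ContDiffAt ℝ k (f ∘ (chartAt E c).symm) (chartAt E c q) := by
  have : IsManifold 𝓘(ℝ, E) k M := IsManifold.of_le (n := ∞) (by exact_mod_cast le_top)
  have := contMDiffAt_iff_source_of_mem_source (I := 𝓘(ℝ, E)) (I' := 𝓘(ℝ, ℝ)) (n := k) (f := f)
    (x := c) (x' := q) hq
  rw [this]
  simp only [mfld_simps, contMDiffWithinAt_univ, contMDiffAt_iff_contDiffAt]

theorem mfderiv_real_apply {c q : M} (hq : q ∈ (chartAt E c).source) {f : M → ℝ}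
    (hf : ContMDiffAt 𝓘(ℝ, E) 𝓘(ℝ, ℝ) 1 f q) (X : TangentSpace 𝓘(ℝ, E) q) :
    mfderiv 𝓘(ℝ, E) 𝓘(ℝ, ℝ) f q X =
      fderiv ℝ (f ∘ (chartAt E c).symm) (chartAt E c q) (toCoords c q X) := by
  have hF : ContDiffAt ℝ 1 (f ∘ (chartAt E c).symm) (chartAt E c q) :=
    (contMDiffAt_real_iff hq (k := 1)).1 hf
  have h1 : HasMFDerivAt 𝓘(ℝ, E) 𝓘(ℝ, E) (extChartAt 𝓘(ℝ, E) c) q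
      (mfderiv 𝓘(ℝ, E) 𝓘(ℝ, E) (extChartAt 𝓘(ℝ, E) c) q) :=
    (mdifferentiableAt_extChartAt hq).hasMFDerivAt
  have h2 : HasMFDerivAt 𝓘(ℝ, E) 𝓘(ℝ, ℝ) (f ∘ (chartAt E c).symm) (extChartAt 𝓘(ℝ, E) c q)
      (fderiv ℝ (f ∘ (chartAt E c).symm) (chartAt E c q)) :=
    (hF.differentiableAt (by simp)).hasFDerivAt.hasMFDerivAt
  have h3 := h2.comp q h1
  have he : f =ᶠ[𝓝 q] (f ∘ (chartAt E c).symm) ∘ extChartAt 𝓘(ℝ, E) c := by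
    filter_upwards [(chartAt E c).open_source.mem_nhds hq] with y hy
    simp [(chartAt E c).left_inv hy]
  rw [(h3.congr_of_eventuallyEq he).mfderiv, toCoords,
    TangentBundle.continuousLinearMapAt_trivializationAt hq]
  rfl

/-- Composition with the chart matches the `C^1` functions near q that vanish on `H` with those on
the model space that vanish on its image, so the annihilated vectors correspond. -/
theorem mem_localTangent_iff {H : Set M} {c q : M} (hq : q ∈ (chartAt E c).source)
    (X : TangentSpace 𝓘(ℝ, E) q) :
    toCoords c q X ∈ localTangent (setInChart H c) (chartAt E c q) ↔ X ∈ tangentSpaceOf H q := by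
  constructor
  · intro h f hf h0
    rw [mfderiv_real_apply hq hf]
    exact h _ ((contMDiffAt_real_iff hq (k := 1)).1 hf) ((tendsto_chart_symm hq).eventually h0)
  · intro h F hF h0
    have he : (F ∘ chartAt E c) ∘ (chartAt E c).symm =ᶠ[𝓝 (chartAt E c q)] F := by
      filter_upwards [(chartAt E c).open_target.mem_nhds ((chartAt E c).map_source hq)] with y hy
      simp [(chartAt E c).right_inv hy]
    have hf : ContMDiffAt 𝓘(ℝ, E) 𝓘(ℝ, ℝ) 1 (F ∘ chartAt E c) q :=
      (contMDiffAt_real_iff hq (k := 1)).2 (hF.congr_of_eventuallyEq he)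
    have := h (F ∘ chartAt E c) hf ((tendsto_chart hq).eventually h0)
    rw [mfderiv_real_apply hq hf, he.fderiv_eq] at this
    exact this

/-- Points of the tangent bundle from coordinates `(x, v)`. -/
def bundlePoint (c : M) (z : E × E) : TangentBundle 𝓘(ℝ, E) M :=
  ⟨(chartAt E c).symm z.1, ofCoords c ((chartAt E c).symm z.1) z.2⟩

theorem contMDiffAt_bundlePoint (c : M) {z : E × E} (hz : z.1 ∈ (chartAt E c).target) :
    ContMDiffAt 𝓘(ℝ, E × E) 𝓘(ℝ, E).tangent ∞ (bundlePoint c) z := by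
  set e := trivializationAt E (TangentSpace 𝓘(ℝ, E) : M → Type _) c
  have hb : ∀ x ∈ (chartAt E c).target, (chartAt E c).symm x ∈ e.baseSet := fun x hx => by
    simpa [e] using (chartAt E c).map_target hx
  have h1 : ContMDiffAt 𝓘(ℝ, E × E) (𝓘(ℝ, E).prod 𝓘(ℝ, E)) ∞
      (fun z : E × E => ((chartAt E c).symm z.1, z.2)) z := by
    refine ContMDiffAt.prodMk ?_ contDiff_snd.contMDiff.contMDiffAt
    exact ContMDiffAt.comp (g := (chartAt E c).symm) (f := fun z : E × E => z.1)
      (I' := 𝓘(ℝ, E)) z ((contMDiffOn_chart_symm (I := 𝓘(ℝ, E))).contMDiffAt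
      ((chartAt E c).open_target.mem_nhds hz)) contDiff_fst.contMDiff.contMDiffAt
  have h2 : ContMDiffAt (𝓘(ℝ, E).prod 𝓘(ℝ, E)) 𝓘(ℝ, E).tangent ∞ e.toOpenPartialHomeomorph.symm
      ((chartAt E c).symm z.1, z.2) :=
    (Bundle.Trivialization.contMDiffOn_symm (IB := 𝓘(ℝ, E)) (n := ∞) e).contMDiffAt
      (e.open_target.mem_nhds (e.mem_target.2 (hb _ hz)))
  refine (h2.comp z h1).congr_of_eventuallyEq ?_
  have : ∀ᶠ w : E × E in 𝓝 z, w.1 ∈ (chartAt E c).target :=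
    continuous_fst.continuousAt.eventually_mem ((chartAt E c).open_target.mem_nhds hz)
  filter_upwards [this] with w hw
  have h := e.mk_symm (hb _ hw) w.2
  rw [← e.symmL_apply (R := ℝ) (hb _ hw)] at h
  exact h

theorem contDiffAt_vecInChart {c q : M} (hq : q ∈ (chartAt E c).source)
    {Y : (q : M) → TangentSpace 𝓘(ℝ, E) q}
    (hY : ContMDiffAt 𝓘(ℝ, E) 𝓘(ℝ, E).tangent 1
      (fun q => (⟨q, Y q⟩ : TangentBundle 𝓘(ℝ, E) M)) q) :
    ContDiffAt ℝ 1 (vecInChart Y c) (chartAt E c q) := by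
  set e := trivializationAt E (TangentSpace 𝓘(ℝ, E) : M → Type _) c
  have hb : ∀ x ∈ (chartAt E c).target, (chartAt E c).symm x ∈ e.baseSet := fun x hx => by
    simpa [e] using (chartAt E c).map_target hx
  have h1 : ContMDiffAt 𝓘(ℝ, E) 𝓘(ℝ, E) 1 (chartAt E c).symm (chartAt E c q) :=
    (contMDiffOn_chart_symm (I := 𝓘(ℝ, E))).contMDiffAt
      ((chartAt E c).open_target.mem_nhds ((chartAt E c).map_source hq))
  have h2 : ContMDiffAt 𝓘(ℝ, E).tangent (𝓘(ℝ, E).prod 𝓘(ℝ, E)) 1 e (⟨q, Y q⟩ : TangentBundle 𝓘(ℝ, E) M) :=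
    (Bundle.Trivialization.contMDiffOn (IB := 𝓘(ℝ, E)) (n := 1) e).contMDiffAt
      (e.open_source.mem_nhds (by simpa [e] using hq))
  have h3 := (h2.comp q hY).snd
  have h4 := (ContMDiffAt.comp (chartAt E c q) (by rwa [(chartAt E c).left_inv hq]) h1 :
    ContMDiffAt 𝓘(ℝ, E) 𝓘(ℝ, E) 1 ((fun x => (e ⟨x, Y x⟩).2) ∘ (chartAt E c).symm) (chartAt E c q))
  refine h4.contDiffAt.congr_of_eventuallyEq ?_
  filter_upwards [(chartAt E c).open_target.mem_nhds ((chartAt E c).map_source hq)] with x hx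
  simp only [vecInChart, toCoords, Function.comp]
  exact e.continuousLinearMapAt_apply_of_mem ℝ (hb x hx) _

end Charts

/-! ### Finsler spacetimes and their null hypersurfaces in a chart. -/

section FinslerInChart

variable {E : Type*} [NormedAddCommGroup E] [NormedSpace ℝ E]
  {M : Type*} [TopologicalSpace M] [ChartedSpace E M] [IsManifold 𝓘(ℝ, E) ∞ M]

theorem vDiff_eq_fderiv {F : Type*} [NormedAddCommGroup F] [NormedSpace ℝ F] {f : E × E → F}
    {x v : E} (hf : DifferentiableAt ℝ f (x, v)) :
    vDiff f (x, v) = fderiv ℝ (fun w => f (x, w)) v := by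
  have h : HasFDerivAt (fun w : E => (x, w)) (ContinuousLinearMap.inr ℝ E E) v :=
    hasFDerivAt_prodMk_right x v
  exact (HasFDerivAt.comp v (g := f) hf.hasFDerivAt h).fderiv.symm

/-- The components of tangent vectors at `q` in the chart around `c`, as a linear equivalence. -/
def coordsEquiv {c q : M} (hq : q ∈ (chartAt E c).source) : E ≃L[ℝ] E :=
  ContinuousLinearEquiv.equivOfInverse (ofCoords c q : E →L[ℝ] E) (toCoords c q : E →L[ℝ] E)
    (toCoords_ofCoords hq) (ofCoords_toCoords hq)

theorem ofCoords_ne_zero {c q : M} (hq : q ∈ (chartAt E c).source) {v : E} (hv : v ≠ 0) :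
    ofCoords c q v ≠ 0 := fun h =>
  hv ((coordsEquiv hq).injective (by rw [map_zero]; exact h))

theorem toCoords_ne_zero {c q : M} (hq : q ∈ (chartAt E c).source) {v : TangentSpace 𝓘(ℝ, E) q}
    (hv : v ≠ 0) : toCoords c q v ≠ 0 := fun h =>
  hv (by rw [← ofCoords_toCoords hq v, h]; exact map_zero _)

namespace FinslerSpacetime

variable (S : FinslerSpacetime E M)

theorem contDiffAt_lagInChart {c : M} {x v : E} (hx : x ∈ (chartAt E c).target) (hv : v ≠ 0) :
    ContDiffAt ℝ ∞ (lagInChart S.L c) (x, v) := by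
  have h1 := contMDiffAt_bundlePoint c (z := (x, v)) hx
  have hev : ∀ᶠ z : E × E in 𝓝 (x, v), z ∈ (chartAt E c).target ×ˢ ({0}ᶜ : Set E) :=
    ((chartAt E c).open_target.prod isOpen_compl_singleton).mem_nhds ⟨hx, hv⟩
  have h2 : ContMDiffWithinAt 𝓘(ℝ, E).tangent 𝓘(ℝ, ℝ) ∞ S.L {v | v.2 ≠ 0} (bundlePoint c (x, v)) :=
    S.smooth _ (ofCoords_ne_zero ((chartAt E c).map_target hx) hv)
  have h3 : ContMDiffWithinAt 𝓘(ℝ, E × E) 𝓘(ℝ, ℝ) ∞ (S.L ∘ bundlePoint c)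
      ((chartAt E c).target ×ˢ ({0}ᶜ : Set E)) (x, v) :=
    ContMDiffWithinAt.comp (x, v) h2 h1.contMDiffWithinAt fun z hz =>
      ofCoords_ne_zero ((chartAt E c).map_target hz.1) hz.2
  exact (h3.contMDiffAt hev).contDiffAt

theorem vDiff_lagInChart {c : M} {x v : E} (hx : x ∈ (chartAt E c).target) (hv : v ≠ 0) (w : E) :
    vDiff (lagInChart S.L c) (x, v) w =
      fderiv ℝ (fun u : E => S.L ⟨(chartAt E c).symm x, u⟩)
        (ofCoords c ((chartAt E c).symm x) v : E) (ofCoords c ((chartAt E c).symm x) w : E) := by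
  rw [vDiff_eq_fderiv ((S.contDiffAt_lagInChart hx hv).differentiableAt (by simp))]
  have h := (coordsEquiv ((chartAt E c).map_target hx)).comp_right_fderiv
    (f := fun u : E => S.L ⟨(chartAt E c).symm x, u⟩) (x := v)
  exact congrArg (fun A => A w) h

/-- With the base point fixed, the chart acts on the fibre by a linear isomorphism, and Hessians
pull back under linear maps without correction terms. -/
theorem metric_lagInChart {c : M} {x v : E} (hx : x ∈ (chartAt E c).target) (hv : v ≠ 0)
    (a b : E) : vDiff (vDiff (lagInChart S.L c)) (x, v) a b =
      fundTensor S.L ((chartAt E c).symm x) (ofCoords c ((chartAt E c).symm x) v)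
        (ofCoords c ((chartAt E c).symm x) a) (ofCoords c ((chartAt E c).symm x) b) := by
  set A := coordsEquiv ((chartAt E c).map_target hx)
  set Lq : E → ℝ := fun u => S.L ⟨(chartAt E c).symm x, u⟩
  have hd := (contDiffAt_vDiff (S.contDiffAt_lagInChart hx hv)).differentiableAt (by simp)
  have he : (fun w => vDiff (lagInChart S.L c) (x, w)) =ᶠ[𝓝 v]
      fun w => (A.arrowCongr (ContinuousLinearEquiv.refl ℝ ℝ)).symm (fderiv ℝ Lq (A w)) := by
    filter_upwards [isOpen_compl_singleton.mem_nhds hv] with w hw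
    ext u
    exact S.vDiff_lagInChart hx hw u
  have h1 := (A.comp_right_fderiv (f := fderiv ℝ Lq) (x := v))
  have h2 := ((A.arrowCongr (ContinuousLinearEquiv.refl ℝ ℝ)).symm).comp_fderiv
    (f := fderiv ℝ Lq ∘ A) (x := v)
  rw [vDiff_eq_fderiv hd, he.fderiv_eq]
  have h3 := congrArg (fun B => B a b) h2
  rw [h1] at h3
  exact h3

theorem isLocalFinsler (c : M) : IsLocalFinsler (lagInChart S.L c) (chartAt E c).target where
  isOpen := (chartAt E c).open_target
  smooth := fun z hz => (S.contDiffAt_lagInChart hz.1 hz.2).contDiffWithinAt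
  homog := by
    intro x hx v hv s hs
    have h := S.homog ((chartAt E c).symm x) (ofCoords c _ v) s
      (ofCoords_ne_zero ((chartAt E c).map_target hx) hv) hs
    rw [← map_smul] at h
    exact h
  lorentzian := by
    intro x hx v hv
    have hq := (chartAt E c).map_target hx
    obtain ⟨hs, T, hT, hT'⟩ := S.lorentzian ((chartAt E c).symm x) (ofCoords c _ v)
      (ofCoords_ne_zero hq hv)
    obtain ⟨t, rfl⟩ : ∃ t : E, ofCoords c ((chartAt E c).symm x) t = T :=
      ⟨_, ofCoords_toCoords hq T⟩
    refine ⟨fun X Y => ?_, t, ?_, fun X hX hX0 => ?_⟩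
    · rw [S.metric_lagInChart hx hv, S.metric_lagInChart hx hv]
      exact hs _ _
    · rw [S.metric_lagInChart hx hv]
      exact hT
    · rw [S.metric_lagInChart hx hv] at hX ⊢
      exact hT' _ hX (ofCoords_ne_zero hq hX0)

theorem ofCoords_vecInChart (Y : (q : M) → TangentSpace 𝓘(ℝ, E) q) {c : M} {x : E}
    (hx : x ∈ (chartAt E c).target) :
    ofCoords c ((chartAt E c).symm x) (vecInChart Y c x) = Y ((chartAt E c).symm x) :=
  ofCoords_toCoords ((chartAt E c).map_target hx) _

theorem vecInChart_chart (Y : (q : M) → TangentSpace 𝓘(ℝ, E) q) {c q : M}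
    (hq : q ∈ (chartAt E c).source) : vecInChart Y c (chartAt E c q) = toCoords c q (Y q) := by
  rw [vecInChart, (chartAt E c).left_inv hq]

theorem vecInChart_self (Y : (q : M) → TangentSpace 𝓘(ℝ, E) q) (p : M) :
    vecInChart Y p (chartAt E p p) = Y p :=
  (vecInChart_chart Y (mem_chart_source E p)).trans (toCoords_self p _)

variable {n : (q : M) → TangentSpace 𝓘(ℝ, E) q}

theorem metricInChart_pullback {c : M} {x : E} (hx : x ∈ (chartAt E c).target)
    (hn : n ((chartAt E c).symm x) ≠ 0) : metricInChart (S.pullbackMetric n) c x =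
      vDiff (vDiff (lagInChart S.L c)) (x, vecInChart n c x) := by
  have hv : vecInChart n c x ≠ 0 := toCoords_ne_zero ((chartAt E c).map_target hx) hn
  ext a b
  rw [S.metric_lagInChart hx hv, ofCoords_vecInChart n hx]
  rfl

theorem metric_chart {c q : M} (hq : q ∈ (chartAt E c).source) (hn : n q ≠ 0) (a b : E) :
    vDiff (vDiff (lagInChart S.L c)) (chartAt E c q, vecInChart n c (chartAt E c q)) a b =
      S.pullbackMetric n q (ofCoords c q a) (ofCoords c q b) := by
  have hx := (chartAt E c).map_source hq
  have hv : vecInChart n c (chartAt E c q) ≠ 0 := by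
    rw [vecInChart_chart n hq]
    exact toCoords_ne_zero hq hn
  rw [S.metric_lagInChart hx hv, ofCoords_vecInChart n hx, (chartAt E c).left_inv hq]
  rfl

theorem conormal_chart {c q : M} (hq : q ∈ (chartAt E c).source) (hn : n q ≠ 0)
    (X : TangentSpace 𝓘(ℝ, E) q) :
    vDiff (lagInChart S.L c) (chartAt E c q, vecInChart n c (chartAt E c q)) (toCoords c q X) =
      S.pullbackMetric n q (n q) X := by
  have hv : vecInChart n c (chartAt E c q) ≠ 0 := by
    rw [vecInChart_chart n hq]
    exact toCoords_ne_zero hq hn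
  rw [← (S.isLocalFinsler c).metric_self ((chartAt E c).map_source hq) hv, S.metric_chart hq hn,
    ofCoords_toCoords hq, vecInChart_chart n hq, ofCoords_toCoords hq]

/-- A null hypersurface in the chart around `c`. -/
theorem isLocalNull {H U : Set M} (hH : S.IsNullHypersurface H) (hU : IsOpen U) (hHU : H ⊆ U)
    (hnU : IsC1VectorFieldOn n U) (hn : ∀ p ∈ H, S.IsNullNormal H p (n p)) {c q : M}
    (hq : q ∈ (chartAt E c).source) (hqH : q ∈ H) :
    IsLocalNull (lagInChart S.L c) (setInChart H c) (vecInChart n c) (chartAt E c q) where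
  mem := (mem_setInChart hq).2 hqH
  contDiffAt := contDiffAt_vecInChart hq (hnU.contMDiffAt (hU.mem_nhds (hHU hqH)))
  ne_zero := by
    rw [vecInChart_chart n hq]
    exact toCoords_ne_zero hq (hn q hqH).1.1
  tangent := by
    filter_upwards [self_mem_nhdsWithin] with y hy X
    have hs := (chartAt E c).map_target hy.1
    have h1 := mem_localTangent_iff (H := H) hs (ofCoords c _ X)
    have h2 := S.conormal_chart hs (hn _ hy.2).1.1 (ofCoords c _ X)
    rw [toCoords_ofCoords hs, (chartAt E c).right_inv hy.1] at h1 h2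
    rw [h1, h2]
    exact (hn _ hy.2).2.2 _
  null := by
    filter_upwards [self_mem_nhdsWithin] with y hy
    have hs := (chartAt E c).map_target hy.1
    have h2 := S.conormal_chart hs (hn _ hy.2).1.1 (n _)
    rw [(chartAt E c).right_inv hy.1] at h2
    exact h2.trans (((hn _ hy.2).2.2 _).1 (hn _ hy.2).2.1)
  regular := by
    obtain ⟨W, f, hW, hqW, hf, hd, hfH⟩ := hH.1 q hqH
    have hfq : ContMDiffAt 𝓘(ℝ, E) 𝓘(ℝ, ℝ) 2 f q := hf.contMDiffAt (hW.mem_nhds hqW)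
    refine ⟨f ∘ (chartAt E c).symm, (contMDiffAt_real_iff hq (k := 2)).1 hfq, fun h0 => ?_, ?_⟩
    · apply hd q hqW
      ext X
      rw [mfderiv_real_apply hq (hfq.of_le (by norm_num)), h0]
      rfl
    · filter_upwards [(chartAt E c).open_target.mem_nhds ((chartAt E c).map_source hq),
        ((chartAt E c).tendsto_symm hq).eventually (hW.mem_nhds hqW)] with y hy hyW
      have : (chartAt E c).symm y ∈ H ∩ W ↔ f ((chartAt E c).symm y) = 0 := by
        rw [hfH]
        exact ⟨fun h => h.2, fun h => ⟨hyW, h⟩⟩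
      rw [Function.comp, ← this]
      exact ⟨fun h => ⟨h.2, hyW⟩, fun h => ⟨hy, h.1⟩⟩

end FinslerSpacetime

end FinslerInChart

/-! ### Comparison of the two connections on the manifold. -/

section Global

variable {E : Type*} [NormedAddCommGroup E] [NormedSpace ℝ E]

theorem christoffel_congr {h h' : E → E →L[ℝ] E →L[ℝ] ℝ} {x : E} (he : h =ᶠ[𝓝 x] h') (X Y : E) :
    christoffel h x X Y = christoffel h' x X Y := by
  rw [christoffel, christoffel, he.fderiv_eq, he.self_of_nhds]

variable {M : Type*} [TopologicalSpace M] [ChartedSpace E M] [IsManifold 𝓘(ℝ, E) ∞ M]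

theorem contMDiffAt_ofCoords {p : M} {w : E → E} (hw : ContDiffAt ℝ 1 w (chartAt E p p)) :
    ContMDiffAt 𝓘(ℝ, E) 𝓘(ℝ, E).tangent 1
      (fun q => (⟨q, ofCoords p q (w (chartAt E p q))⟩ : TangentBundle 𝓘(ℝ, E) M)) p := by
  have hp := mem_chart_source E p
  have h1 : ContMDiffAt 𝓘(ℝ, E) 𝓘(ℝ, E) 1 (chartAt E p) p :=
    (contMDiffOn_chart (I := 𝓘(ℝ, E))).contMDiffAt ((chartAt E p).open_source.mem_nhds hp)
  have h2 : ContMDiffAt 𝓘(ℝ, E) 𝓘(ℝ, E × E) 1 (fun q => (chartAt E p q, w (chartAt E p q))) p :=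
    ContMDiffAt.comp (g := fun y => (y, w y)) (I' := 𝓘(ℝ, E)) p
      (contDiffAt_id.prodMk hw).contMDiffAt h1
  have h3 : ContMDiffAt 𝓘(ℝ, E) 𝓘(ℝ, E).tangent 1
      (fun q => bundlePoint p (chartAt E p q, w (chartAt E p q))) p :=
    ContMDiffAt.comp (g := bundlePoint p) (I' := 𝓘(ℝ, E × E)) p
      ((contMDiffAt_bundlePoint p ((chartAt E p).map_source hp)).of_le ENat.LEInfty.out) h2
  refine h3.congr_of_eventuallyEq ?_
  filter_upwards [(chartAt E p).open_source.mem_nhds hp] with q hq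
  simp only [bundlePoint]
  rw [(chartAt E p).left_inv hq]

namespace FinslerSpacetime

variable (S : FinslerSpacetime E M) {H U : Set M}
  {n : (q : M) → TangentSpace 𝓘(ℝ, E) q}

theorem covD_eq (n : (q : M) → TangentSpace 𝓘(ℝ, E) q) (p : M) (X : TangentSpace 𝓘(ℝ, E) p) :
    S.covD n p X = fderiv ℝ (vecInChart n p) (chartAt E p p) X +
      nonlinConn (lagInChart S.L p) (chartAt E p p, vecInChart n p (chartAt E p p)) X := by
  rw [vecInChart_self]
  rfl

/-- `n` is a `C^1` field of lightlike normals of the null hypersurface `H`, extended to the open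
set `U`. -/
structure IsNullNormalField (H U : Set M) (n : (q : M) → TangentSpace 𝓘(ℝ, E) q) : Prop where
  null : S.IsNullHypersurface H
  isOpen : IsOpen U
  subset : H ⊆ U
  contDiff : IsC1VectorFieldOn n U
  normal : ∀ p ∈ H, S.IsNullNormal H p (n p)

namespace IsNullNormalField

variable {S} (hn : S.IsNullNormalField H U n) {p : M} (hp : p ∈ H)
include hn

theorem isLocalNull {c q : M} (hq : q ∈ (chartAt E c).source) (hqH : q ∈ H) :
    IsLocalNull (lagInChart S.L c) (setInChart H c) (vecInChart n c) (chartAt E c q) :=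
  S.isLocalNull hn.null hn.isOpen hn.subset hn.contDiff hn.normal hq hqH

theorem ne_zero {p : M} (hp : p ∈ H) : n p ≠ 0 := (hn.normal p hp).1.1

theorem mem_tangent_iff {p : M} (hp : p ∈ H) (X : TangentSpace 𝓘(ℝ, E) p) :
    X ∈ tangentSpaceOf H p ↔ S.pullbackMetric n p (n p) X = 0 :=
  (hn.normal p hp).2.2 X

/-- Christoffel symbols depend on the metric near a point, not just at it. Continuity keeps n
nonzero nearby, where the fibre Hessian is the vertical Hessian of a smooth function. -/
theorem metricInChart_eventuallyEq {c q : M} (hq : q ∈ (chartAt E c).source) (hqU : q ∈ U)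
    (hq0 : n q ≠ 0) : metricInChart (S.pullbackMetric n) c =ᶠ[𝓝 (chartAt E c q)]
      fun y => vDiff (vDiff (lagInChart S.L c)) (y, vecInChart n c y) := by
  have hc : ContinuousAt (vecInChart n c) (chartAt E c q) :=
    (contDiffAt_vecInChart hq (hn.contDiff.contMDiffAt (hn.isOpen.mem_nhds hqU))).continuousAt
  have h0 : vecInChart n c (chartAt E c q) ≠ 0 := by
    rw [vecInChart_chart n hq]
    exact toCoords_ne_zero hq hq0
  filter_upwards [(chartAt E c).open_target.mem_nhds ((chartAt E c).map_source hq),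
    hc.eventually_ne h0] with y hy hy0
  refine S.metricInChart_pullback hy fun h => hy0 ?_
  rw [vecInChart, h, map_zero]

theorem nabla_eq {p : M} (hp : p ∈ H) (Y : (q : M) → TangentSpace 𝓘(ℝ, E) q) (X : TangentSpace 𝓘(ℝ, E) p) :
    Lorentz.nabla (S.pullbackMetric n) Y p X = fderiv ℝ (vecInChart Y p) (chartAt E p p) X +
      christoffel (fun y => vDiff (vDiff (lagInChart S.L p)) (y, vecInChart n p y))
        (chartAt E p p) X (vecInChart Y p (chartAt E p p)) := by
  rw [vecInChart_self]
  exact congrArg (fun a : E => fderiv ℝ (vecInChart Y p) (chartAt E p p) X + a)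
    (christoffel_congr (hn.metricInChart_eventuallyEq (mem_chart_source E p) (hn.subset hp)
      (hn.ne_zero hp)) _ _)

theorem metric_self_chart {p : M} (hp : p ∈ H) (a b : E) : vDiff (vDiff (lagInChart S.L p))
    (chartAt E p p, vecInChart n p (chartAt E p p)) a b = S.pullbackMetric n p a b := by
  rw [S.metric_chart (mem_chart_source E p) (hn.ne_zero hp)]
  exact congrArg₂ (fun a b => S.pullbackMetric n p a b) (ofCoords_self p a) (ofCoords_self p b)

/-- Tangent vectors of `H` extend to `C^1` fields tangent to `H`. -/
theorem exists_tangent_field {p : M} (hp : p ∈ H) {Z : TangentSpace 𝓘(ℝ, E) p} (hZ : Z ∈ tangentSpaceOf H p) :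
    ∃ Y : (q : M) → TangentSpace 𝓘(ℝ, E) q, Y p = Z ∧
      ContMDiffAt 𝓘(ℝ, E) 𝓘(ℝ, E).tangent 1
        (fun q => (⟨q, Y q⟩ : TangentBundle 𝓘(ℝ, E) M)) p ∧
      ∀ᶠ q in 𝓝[H] p, Y q ∈ tangentSpaceOf H q := by
  obtain ⟨z, rfl⟩ : ∃ z : E, z = Z := ⟨Z, rfl⟩
  have hps := mem_chart_source E p
  have hpt := (chartAt E p).map_source hps
  have hN := hn.isLocalNull hps hp
  have hℓ := S.isLocalFinsler p
  set α : E → E →L[ℝ] ℝ := fun y => vDiff (lagInChart S.L p) (y, vecInChart n p y)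
  have hα : ContDiffAt ℝ 1 α (chartAt E p p) := hN.contDiffAt_conormal hℓ hpt
  obtain ⟨e, he⟩ : ∃ e, α (chartAt E p p) e ≠ 0 := by
    by_contra! hc
    exact hN.conormal_ne_zero hℓ hpt (ContinuousLinearMap.ext hc)
  have hαZ : α (chartAt E p p) z = 0 :=
    (congrArg (α (chartAt E p p)) (toCoords_self p z)).symm.trans
      ((S.conormal_chart hps (hn.ne_zero hp) z).trans ((hn.mem_tangent_iff hp z).1 hZ))
  -- The constant field z is corrected along e into the kernel of the conormal α; at p nothing is
  -- subtracted, since α(z) = 0 there.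
  let w : E → E := fun y => z - (α y z / α y e) • e
  have hαc : ∀ a : E, ContDiffAt ℝ 1 (fun y => α y a) (chartAt E p p) := fun a =>
    hα.clm_apply contDiffAt_const
  have hw : ContDiffAt ℝ 1 w (chartAt E p p) :=
    contDiffAt_const.sub (((hαc z).div (hαc e) he).smul contDiffAt_const)
  refine ⟨fun q => ofCoords p q (w (chartAt E p q)), ?_, contMDiffAt_ofCoords hw, ?_⟩
  · have hwz : w (chartAt E p p) = z := by simp [w, hαZ]
    exact (ofCoords_self p _).trans hwz
  · have he' : ∀ᶠ y in 𝓝 (chartAt E p p), α y e ≠ 0 := (hαc e).continuousAt.eventually_ne he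
    filter_upwards [nhdsWithin_le_nhds ((chartAt E p).open_source.mem_nhds hps),
      nhdsWithin_le_nhds (((chartAt E p).continuousAt hps).eventually he'),
      self_mem_nhdsWithin] with q hq hqe hqH
    rw [hn.mem_tangent_iff hqH, ← S.conormal_chart hq (hn.ne_zero hqH), toCoords_ofCoords hq]
    change α (chartAt E p q) (w (chartAt E p q)) = 0
    simp [w, hqe]

variable [FiniteDimensional ℝ E]
include hp

/-- The two covariant derivatives of the lightlike field coincide on `H`. -/
theorem covD_eq_nabla (X : TangentSpace 𝓘(ℝ, E) p) :
    S.covD n p X = Lorentz.nabla (S.pullbackMetric n) n p X := by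
  rw [S.covD_eq, hn.nabla_eq hp]
  congr 1
  exact (hn.isLocalNull (mem_chart_source E p) hp).nonlinConn_eq_christoffel (S.isLocalFinsler p)
    ((chartAt E p).map_source (mem_chart_source E p)) X

theorem covD_self_mem_span : S.covD n p (n p) ∈ Submodule.span ℝ {n p} := by
  have h := (hn.isLocalNull (mem_chart_source E p) hp).covariantDeriv_self_mem_span
    (S.isLocalFinsler p) ((chartAt E p).map_source (mem_chart_source E p))
  rw [vecInChart_self] at h
  exact h

/-- The derivative along `H` of the vanishing function `g_n(n, Y)`. -/
theorem metric_nabla_add {X : TangentSpace 𝓘(ℝ, E) p} (hX : X ∈ tangentSpaceOf H p)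
    {Y : (q : M) → TangentSpace 𝓘(ℝ, E) q}
    (hY : ContMDiffAt 𝓘(ℝ, E) 𝓘(ℝ, E).tangent 1
      (fun q => (⟨q, Y q⟩ : TangentBundle 𝓘(ℝ, E) M)) p)
    (hYH : ∀ᶠ q in 𝓝[H] p, Y q ∈ tangentSpaceOf H q) :
    S.pullbackMetric n p (Lorentz.nabla (S.pullbackMetric n) n p X) (Y p) +
      S.pullbackMetric n p (n p) (Lorentz.nabla (S.pullbackMetric n) Y p X) = 0 := by
  have hps := mem_chart_source E p
  have hpt := (chartAt E p).map_source hps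
  have hN := hn.isLocalNull hps hp
  have hℓ := S.isLocalFinsler p
  have hh := hN.contDiffAt_metric hℓ hpt
  have hYc : ContDiffAt ℝ 1 (vecInChart Y p) (chartAt E p p) := contDiffAt_vecInChart hps hY
  have h1 := fderiv_metric_apply_apply (hh.differentiableAt (by simp))
    (hN.eventually_lorentzian hℓ hpt) (hN.contDiffAt.differentiableAt (by simp))
    (hYc.differentiableAt (by simp)) X
  have hX' : (X : E) ∈ localTangent (setInChart H p) (chartAt E p p) := by
    have := (mem_localTangent_iff (H := H) hps X).2 hX
    rwa [toCoords_self] at this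
  have h2 := hX' _ ((hh.clm_apply hN.contDiffAt).clm_apply hYc) (by
    filter_upwards [(tendsto_chart_symm hps).eventually hYH, self_mem_nhdsWithin] with y hy hyH
    have hs := (chartAt E p).map_target hyH.1
    have h3 := S.metric_chart hs (hn.ne_zero hyH.2) (vecInChart n p y) (vecInChart Y p y)
    rw [(chartAt E p).right_inv hyH.1, ofCoords_vecInChart n hyH.1,
      ofCoords_vecInChart Y hyH.1] at h3
    rw [h3]
    exact (hn.mem_tangent_iff hyH.2 _).1 hy)
  rw [h1] at h2
  have e1 := hn.nabla_eq hp n X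
  have e2 := hn.nabla_eq hp Y X
  have m1 := hn.metric_self_chart hp (Lorentz.nabla (S.pullbackMetric n) n p X) (Y p)
  have m2 := hn.metric_self_chart hp (n p) (Lorentz.nabla (S.pullbackMetric n) Y p X)
  rw [← m1, ← m2, e1, e2, ← h2, vecInChart_self, vecInChart_self]

omit hp in
-- Since g_n(∇_X n, Y) = -g_n(n, ∇_X Y) for tangent fields Y, ∇_X n is orthogonal to T`H` exactly
-- when every ∇_X Y lies in ker g_n(n, ·) = T`H`. Orthogonality of ∇_X n to T`H` means
-- proportionality to n, and `exists_tangent_field` supplies enough fields Y.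
theorem isTotallyGeodesic_iff : S.IsTotallyGeodesic H n ↔
    Lorentz.IsTotallyGeodesic (S.pullbackMetric n) H := by
  constructor
  · intro h p hp X hX Y hY hYH
    have h1 := hn.metric_nabla_add hp hX hY hYH
    obtain ⟨c, hc⟩ := Submodule.mem_span_singleton.1 (h p hp X hX)
    rw [← hn.covD_eq_nabla hp, ← hc, map_smul, smul_apply,
      (hn.mem_tangent_iff hp _).1 (hYH.self_of_nhdsWithin hp), smul_zero, zero_add] at h1
    exact (hn.mem_tangent_iff hp _).2 h1
  · intro h p hp X hX
    rw [hn.covD_eq_nabla hp]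
    refine (S.lorentzian p (n p) (hn.ne_zero hp)).mem_span (hn.ne_zero hp) fun Z hZ => ?_
    obtain ⟨Y, rfl, hY, hYH⟩ := hn.exists_tangent_field hp ((hn.mem_tangent_iff hp Z).2 hZ)
    have h1 := hn.metric_nabla_add hp hX hY hYH
    rw [(hn.mem_tangent_iff hp _).1 (h p hp X hX Y hY hYH), add_zero] at h1
    exact h1

/-- The covariant derivative of `n` in the chart around another point. -/
theorem toCoords_covD {c : M} (hc : p ∈ (chartAt E c).source) (X : TangentSpace 𝓘(ℝ, E) p) :
    toCoords c p (S.covD n p X) =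
      fderiv ℝ (vecInChart n c) (chartAt E c p) (toCoords c p X) +
        nonlinConn (lagInChart S.L c) (chartAt E c p, vecInChart n c (chartAt E c p))
          (toCoords c p X) := by
  obtain ⟨a, rfl⟩ : ∃ a : E, a = X := ⟨X, rfl⟩
  have hps := mem_chart_source E p
  have hpt := (chartAt E p).map_source hps
  have hct := (chartAt E c).map_source hc
  have hN := hn.isLocalNull hps hp
  have hNc := hn.isLocalNull hc hp
  set ψ : E → E := chartAt E c ∘ (chartAt E p).symm
  have hψp : ψ (chartAt E p p) = chartAt E c p := by simp [ψ]
  have hψ' : ∀ᶠ y in 𝓝 (chartAt E p p), y ∈ (chartAt E p).target ∧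
      (chartAt E p).symm y ∈ (chartAt E c).source ∧ vecInChart n p y ≠ 0 ∧
      fderiv ℝ ψ y = ((toCoords c ((chartAt E p).symm y)).comp
        (ofCoords p ((chartAt E p).symm y)) : E →L[ℝ] E) := by
    filter_upwards [(chartAt E p).open_target.mem_nhds hpt,
      ((chartAt E p).tendsto_symm hps).eventually ((chartAt E c).open_source.mem_nhds hc),
      hN.contDiffAt.continuousAt.eventually_ne hN.ne_zero] with y hy hyc hy0
    refine ⟨hy, hyc, hy0, ?_⟩
    have := hasFDerivAt_coordChange ((chartAt E p).map_target hy) hyc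
    rw [(chartAt E p).right_inv hy] at this
    exact this.fderiv
  have hψ'p : ∀ a, fderiv ℝ ψ (chartAt E p p) a = toCoords c p (a : TangentSpace 𝓘(ℝ, E) p) := by
    intro a
    have := (hasFDerivAt_coordChange hps hc).fderiv
    rw [this]
    exact congrArg (toCoords c p) (ofCoords_self p a)
  have hsurj : Function.Surjective (fderiv ℝ ψ (chartAt E p p)) := fun a =>
    ⟨ofCoords c p a, (hψ'p _).trans (toCoords_ofCoords hc a)⟩
  -- The change of chart is carried out for the Levi-Civita connection of `g_n`; on `H` the two
  -- derivatives of n agree in either chart, so no transformation law for N is needed.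
  have key := covariantDeriv_coordChange
    (h := fun y => vDiff (vDiff (lagInChart S.L p)) (y, vecInChart n p y))
    (h' := fun y => vDiff (vDiff (lagInChart S.L c)) (y, vecInChart n c y))
    (ψ := ψ) (Y := vecInChart n p) (Y' := vecInChart n c)
    ((contDiffAt_coordChange hps hc).of_le ENat.LEInfty.out) hsurj ?_
    ((hN.contDiffAt_metric (S.isLocalFinsler p) hpt).differentiableAt (by simp))
    (by
      rw [hψp]
      exact (hNc.contDiffAt_metric (S.isLocalFinsler c) hct).differentiableAt (by simp))
    (hN.eventually_lorentzian (S.isLocalFinsler p) hpt).self_of_nhds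
    (by
      rw [hψp]
      exact (hNc.eventually_lorentzian (S.isLocalFinsler c) hct).self_of_nhds)
    (hN.contDiffAt.differentiableAt (by simp))
    (by rw [hψp]; exact hNc.contDiffAt.differentiableAt (by simp)) ?_ a
  · rw [hψp, hψ'p a] at key
    rw [hNc.nonlinConn_eq_christoffel (S.isLocalFinsler c) hct, ← key]
    exact (congrArg (toCoords c p) ((hn.covD_eq_nabla hp a).trans (hn.nabla_eq hp n a))).trans
      (hψ'p _).symm
  · filter_upwards [hψ'] with y ⟨hy, hyc, hy0, hyd⟩ a b
    have h0 : n ((chartAt E p).symm y) ≠ 0 := fun h => hy0 (by rw [vecInChart, h, map_zero])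
    have e1 := S.metric_chart ((chartAt E p).map_target hy) h0 a b
    rw [(chartAt E p).right_inv hy] at e1
    have e2 := S.metric_chart hyc h0 (fderiv ℝ ψ y a) (fderiv ℝ ψ y b)
    rw [hyd] at e2 ⊢
    refine e1.trans (Eq.trans ?_ e2.symm)
    exact congrArg₂ (fun a b => S.pullbackMetric n _ a b) (ofCoords_toCoords hyc _).symm
      (ofCoords_toCoords hyc _).symm
  · filter_upwards [hψ'] with y ⟨hy, hyc, hy0, hyd⟩
    rw [hyd]
    refine (vecInChart_chart n hyc).trans ?_
    exact congrArg (toCoords c _) (ofCoords_vecInChart n hy).symm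

omit hp in
/-- The generators of `H` have the same affine parametrizations for `L` and for `g_n`. -/
theorem isGeodesicOn_iff {J : Set ℝ} {γ : ℝ → M} {α : ℝ → ℝ}
    (hγ : ∀ t ∈ J, γ t ∈ H ∧ 0 < α t ∧ HasMFDerivAt 𝓘(ℝ, ℝ) 𝓘(ℝ, E) γ t
      ((1 : ℝ →L[ℝ] ℝ).smulRight (α t • n (γ t)))) :
    S.IsGeodesicOn γ J ↔ Lorentz.IsGeodesicOn (S.pullbackMetric n) γ J := by
  have key : ∀ t ∈ J, deriv (fun s => chartAt E (γ t) (γ s)) t ≠ 0 ∧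
      S.accel γ t = Lorentz.accel (S.pullbackMetric n) γ t := by
    intro t ht
    obtain ⟨htH, hα, hd⟩ := hγ t ht
    have hps := mem_chart_source E (γ t)
    have hpt := (chartAt E (γ t)).map_source hps
    have hN := hn.isLocalNull hps htH
    obtain ⟨v, hvn⟩ : ∃ v : E, v = n (γ t) := ⟨_, rfl⟩
    have hv : v ≠ 0 := hvn ▸ hn.ne_zero htH
    have hvc : vecInChart n (γ t) (chartAt E (γ t) (γ t)) = v :=
      (vecInChart_self n (γ t)).trans hvn.symm
    have h1 : deriv (fun s => chartAt E (γ t) (γ s)) t = α t • v := by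
      have h2 : HasFDerivWithinAt (writtenInExtChartAt 𝓘(ℝ, ℝ) 𝓘(ℝ, E) t γ)
          ((1 : ℝ →L[ℝ] ℝ).smulRight (α t • v)) (range 𝓘(ℝ, ℝ)) (extChartAt 𝓘(ℝ, ℝ) t t) := by
        rw [hvn]
        exact hd.2
      simp only [mfld_simps, hasFDerivWithinAt_univ] at h2
      have h3 : deriv (fun s => chartAt E (γ t) (γ s)) t = _ := h2.hasDerivAt.deriv
      simpa using h3
    refine ⟨by rw [h1]; exact smul_ne_zero hα.ne' hv, ?_⟩
    have hs := (S.isLocalFinsler (γ t)).homogOn_spray _ hpt _ hv _ hα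
    have hself := (S.isLocalFinsler (γ t)).nonlinConn_self hpt hv
    have hΓ := hN.nonlinConn_eq_christoffel (S.isLocalFinsler (γ t)) hpt v
    rw [hvc] at hΓ
    -- The second derivatives are the same term, and for velocity α n the rest agrees: α² · 2 G(n) =
    -- α² N(n)(n) = α² Γ(n, n).
    rw [accel, Lorentz.accel, h1, hs, christoffel_smul,
      christoffel_congr (hn.metricInChart_eventuallyEq hps (hn.subset htH) (hn.ne_zero htH)),
      ← hΓ, hself, smul_comm, sq]
  constructor
  · intro h t ht
    exact ⟨(h t ht).1, (key t ht).2 ▸ (h t ht).2.2⟩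
  · intro h t ht
    exact ⟨(h t ht).1, (key t ht).1, (key t ht).2.trans (h t ht).2⟩

end IsNullNormalField

end FinslerSpacetime

end Global

/-! ### Local connectedness of one side of a regular level set. -/

section HalfBall

/-- Near a regular zero of `f`, the set `f < 0` is connected and has the zeros of `f` in its
closure. -/
theorem exists_nhds_isPreconnected_neg {F : Type*} [NormedAddCommGroup F] [NormedSpace ℝ F]
    [CompleteSpace F] {f : F → ℝ} {z₀ : F} {O : Set F} (hf : ContDiffAt ℝ 1 f z₀) (h0 : f z₀ = 0)
    (hd : fderiv ℝ f z₀ ≠ 0) (hO : O ∈ 𝓝 z₀) :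
    ∃ V ∈ 𝓝 z₀, V ⊆ O ∧ IsPreconnected (V ∩ {z | f z < 0}) ∧
      ∀ z ∈ V, f z = 0 → z ∈ closure (V ∩ {z | f z < 0}) := by
  obtain ⟨Ψ, hz, hΨ, -, -, hfΨ⟩ := exists_straightening (by simp) hf h0 hd
  set a := fderiv ℝ f z₀
  obtain ⟨e, he⟩ : ∃ e, 0 < a e := by
    obtain ⟨e, he⟩ : ∃ e, a e ≠ 0 := by
      by_contra! hc
      exact hd (ContinuousLinearMap.ext hc)
    rcases lt_or_gt_of_ne he with h | h
    · exact ⟨-e, by simpa using h⟩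
    · exact ⟨e, h⟩
  have hs : Ψ.symm 0 = z₀ := by rw [← hΨ, Ψ.left_inv hz]
  have ht : (0 : F) ∈ Ψ.target := hΨ ▸ Ψ.map_source hz
  have hmem : Ψ.target ∩ Ψ.symm ⁻¹' O ∈ 𝓝 (0 : F) :=
    Filter.inter_mem (Ψ.open_target.mem_nhds ht)
      ((Ψ.continuousAt_symm ht).preimage_mem_nhds (by rwa [hs]))
  obtain ⟨r, hr, hball⟩ := Metric.mem_nhds_iff.1 hmem
  -- After straightening, f is the linear form a, so the negative side is the image of a half ball.
  -- This is convex, hence connected, and zeros of a are limits of y - t e with a e > 0.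
  have himage : (Ψ.source ∩ Ψ ⁻¹' Metric.ball 0 r) ∩ {z | f z < 0} =
      Ψ.symm '' (Metric.ball 0 r ∩ {y | a y < 0}) := by
    ext z
    constructor
    · rintro ⟨⟨h1, h2⟩, h3⟩
      refine ⟨Ψ z, ⟨h2, ?_⟩, Ψ.left_inv h1⟩
      rw [mem_ofPred_eq, hfΨ]
      exact h3
    · rintro ⟨y, ⟨hy, hy0⟩, rfl⟩
      have hyt := (hball hy).1
      refine ⟨⟨Ψ.map_target hyt, ?_⟩, ?_⟩
      · rw [mem_preimage, Ψ.right_inv hyt]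
        exact hy
      · rw [mem_ofPred_eq, ← hfΨ, Ψ.right_inv hyt]
        exact hy0
  have hsub : Metric.ball 0 r ∩ {y | a y < 0} ⊆ Ψ.target := fun y hy => (hball hy.1).1
  refine ⟨Ψ.source ∩ Ψ ⁻¹' Metric.ball 0 r, ?_, ?_, ?_, ?_⟩
  · refine Filter.inter_mem (Ψ.open_source.mem_nhds hz)
      ((Ψ.continuousAt hz).preimage_mem_nhds ?_)
    rw [hΨ]
    exact Metric.ball_mem_nhds 0 hr
  · rintro z ⟨h1, h2⟩
    have := (hball h2).2
    rwa [mem_preimage, Ψ.left_inv h1] at this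
  · rw [himage]
    refine IsPreconnected.image (Convex.isPreconnected ?_) _ (Ψ.continuousOn_symm.mono hsub)
    exact (convex_ball 0 r).inter (convex_halfSpace_lt a.isLinear 0)
  · rintro z ⟨h1, h2⟩ h3
    have haz : a (Ψ z) = 0 := by rw [hfΨ, h3]
    have hcl : Ψ z ∈ closure (Metric.ball 0 r ∩ {y | a y < 0}) := by
      have htend : Filter.Tendsto (fun t : ℝ => Ψ z - t • e) (𝓝[>] 0) (𝓝 (Ψ z)) := by
        have : Continuous fun t : ℝ => Ψ z - t • e := by fun_prop
        simpa using (this.tendsto 0).mono_left nhdsWithin_le_nhds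
      refine mem_closure_of_tendsto htend ?_
      filter_upwards [htend.eventually (Metric.isOpen_ball.mem_nhds h2), self_mem_nhdsWithin]
        with t ht1 ht2
      refine ⟨ht1, ?_⟩
      simpa [haz] using mul_pos (mem_Ioi.1 ht2) he
    rw [himage]
    have := ((Ψ.continuousAt_symm (Ψ.map_source h1)).continuousWithinAt).mem_closure_image hcl
    rwa [Ψ.left_inv h1] at this

end HalfBall

/-! ### The future light cone, the spacetime of `g_n`, and the Ricci argument. -/

section Global

variable {E : Type*} [NormedAddCommGroup E] [NormedSpace ℝ E]
  {M : Type*} [TopologicalSpace M] [ChartedSpace E M] [IsManifold 𝓘(ℝ, E) ∞ M]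

theorem continuousAt_toCoords {Y : (q : M) → TangentSpace 𝓘(ℝ, E) q} {p : M}
    (hY : ContinuousAt (fun q => (⟨q, Y q⟩ : TangentBundle 𝓘(ℝ, E) M)) p) :
    ContinuousAt (fun q => toCoords p q (Y q)) p := by
  set e := trivializationAt E (TangentSpace 𝓘(ℝ, E) : M → Type _) p
  have hp : p ∈ e.baseSet := mem_baseSet_trivializationAt E _ p
  have h1 : ContinuousAt e (⟨p, Y p⟩ : TangentBundle 𝓘(ℝ, E) M) :=
    e.toOpenPartialHomeomorph.continuousAt (e.mem_source.2 hp)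
  have h2 : ContinuousAt (fun q => (e ⟨q, Y q⟩).2) p :=
    continuousAt_snd.comp (ContinuousAt.comp (g := e) h1 hY)
  refine h2.congr ?_
  filter_upwards [e.open_baseSet.mem_nhds hp] with q hq
  exact (e.continuousLinearMapAt_apply_of_mem ℝ hq _).symm

namespace FinslerSpacetime

variable (S : FinslerSpacetime E M)

theorem bundlePoint_self (p : M) (v : E) :
    bundlePoint p (chartAt E p p, v) = (⟨p, v⟩ : TangentBundle 𝓘(ℝ, E) M) := by
  simp only [bundlePoint]
  rw [(chartAt E p).left_inv (mem_chart_source E p)]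
  exact congrArg (fun w : E => (⟨p, w⟩ : TangentBundle 𝓘(ℝ, E) M)) (ofCoords_self p v)

theorem lagInChart_self (p : M) (v : E) : lagInChart S.L p (chartAt E p p, v) = S.L ⟨p, v⟩ :=
  congrArg S.L (bundlePoint_self p v)

/-- Near a future-directed lightlike vector at `p`, the solutions `w` of `L w = 0` are
future-directed lightlike. -/
theorem eventually_isFutureLightlike [FiniteDimensional ℝ E] {p : M} {v : E}
    (hv : S.IsFutureLightlike p v) (hL : S.L ⟨p, v⟩ = 0) :
    ∀ᶠ w : E in 𝓝 v, S.L ⟨p, w⟩ = 0 → S.IsFutureLightlike p w := by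
  have hps := mem_chart_source E p
  have hpt := (chartAt E p).map_source hps
  have hℓ := S.isLocalFinsler p
  have hv0 : v ≠ 0 := hv.1
  have hc : ContDiffAt ℝ 1 (lagInChart S.L p) (chartAt E p p, v) :=
    (hℓ.contDiffAt hpt hv0).of_le ENat.LEInfty.out
  have hd : fderiv ℝ (lagInChart S.L p) (chartAt E p p, v) ≠ 0 := by
    intro h
    refine hv0 ((hℓ.lorentzian _ hpt v hv0).eq_zero fun Y => ?_)
    rw [hℓ.metric_self hpt hv0, vDiff_apply, h]
    rfl
  -- The half ball is taken in the (x, v)-space rather than in one fibre: `future` is a component in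
  -- the whole tangent bundle, and its points approaching v may lie over other base points.
  obtain ⟨V, hV, hVO, hVc, hVcl⟩ := exists_nhds_isPreconnected_neg hc
    ((S.lagInChart_self p v).trans hL) hd (hℓ.mem_nhds hpt hv0)
  obtain ⟨v₀, hv₀, hLv₀, hfut⟩ := S.future_component
  set A : Set (TangentBundle 𝓘(ℝ, E) M) := {v | v.2 ≠ 0 ∧ S.L v < 0}
  have hcont : ∀ z ∈ V, ContinuousAt (bundlePoint p) z := fun z hz =>
    (contMDiffAt_bundlePoint p (hVO hz).1).continuousAt
  have hpre : IsPreconnected (bundlePoint p '' (V ∩ {z | lagInChart S.L p z < 0})) :=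
    hVc.image _ fun z hz => (hcont z hz.1).continuousWithinAt
  have hA : bundlePoint p '' (V ∩ {z | lagInChart S.L p z < 0}) ⊆ A := by
    rintro _ ⟨z, ⟨hzV, hz⟩, rfl⟩
    exact ⟨ofCoords_ne_zero ((chartAt E p).map_target (hVO hzV).1) (hVO hzV).2, hz⟩
  -- the half ball meets the future cone, hence is contained in it
  have hsub : bundlePoint p '' (V ∩ {z | lagInChart S.L p z < 0}) ⊆ S.future := by
    set e := trivializationAt E (TangentSpace 𝓘(ℝ, E) : M → Type _) p
    let κ : TangentBundle 𝓘(ℝ, E) M → E × E := fun w => (chartAt E p w.1, toCoords p w.1 w.2)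
    have hκ : ∀ᶠ w in 𝓝 (⟨p, v⟩ : TangentBundle 𝓘(ℝ, E) M), κ w ∈ V ∧ bundlePoint p (κ w) = w := by
      have hproj : ContinuousAt (fun w : TangentBundle 𝓘(ℝ, E) M => w.1) ⟨p, v⟩ :=
        (FiberBundle.continuous_proj E (TangentSpace 𝓘(ℝ, E) : M → Type _)).continuousAt
      have hsrc : ∀ᶠ w in 𝓝 (⟨p, v⟩ : TangentBundle 𝓘(ℝ, E) M), w.1 ∈ (chartAt E p).source :=
        hproj.eventually_mem ((chartAt E p).open_source.mem_nhds hps)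
      have he : ContinuousAt (fun w : TangentBundle 𝓘(ℝ, E) M => (e w).2) ⟨p, v⟩ :=
        continuousAt_snd.comp (e.toOpenPartialHomeomorph.continuousAt
          (e.mem_source.2 (mem_baseSet_trivializationAt E _ p)))
      have hκc : ContinuousAt κ ⟨p, v⟩ := by
        refine ContinuousAt.prodMk (ContinuousAt.comp (g := chartAt E p)
          ((chartAt E p).continuousAt hps) hproj) (he.congr ?_)
        filter_upwards [hsrc] with w hw
        exact (e.continuousLinearMapAt_apply_of_mem ℝ (by simpa [e] using hw) _).symm
      have hκv : κ ⟨p, v⟩ = (chartAt E p p, v) :=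
        Prod.ext rfl (toCoords_self p (v : TangentSpace 𝓘(ℝ, E) p))
      filter_upwards [hsrc, hκc.eventually_mem (s := V) (by rwa [hκv])] with w hw hwV
      refine ⟨hwV, ?_⟩
      simp only [bundlePoint, κ]
      rw [(chartAt E p).left_inv hw, ofCoords_toCoords hw]
    obtain ⟨w, hw, hwf⟩ := (mem_closure_iff_frequently.1 hv.2.1).and_eventually hκ |>.exists
    have hwA : w ∈ A := by
      rw [hfut] at hw
      exact connectedComponentIn_subset _ _ hw
    have hwim : w ∈ bundlePoint p '' (V ∩ {z | lagInChart S.L p z < 0}) := by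
      refine ⟨κ w, ⟨hwf.1, ?_⟩, hwf.2⟩
      change S.L (bundlePoint p (κ w)) < 0
      rw [hwf.2]
      exact hwA.2
    rw [hfut] at hw ⊢
    rw [connectedComponentIn_eq hw]
    exact hpre.subset_connectedComponentIn hwim hA
  have hpair : ContinuousAt (fun w : E => (chartAt E p p, w)) v := by fun_prop
  filter_upwards [hpair.eventually_mem hV] with w hw hw0
  have hw' : lagInChart S.L p (chartAt E p p, w) = 0 := (S.lagInChart_self p w).trans hw0
  -- A zero of L in V is a limit of the half ball, which lies in `future`; it is not an interior
  -- point, because L < 0 on `future`.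
  refine ⟨(hVO hw).2, ?_, fun hint => ?_⟩
  · have h1 := ((hcont _ hw).continuousWithinAt).mem_closure_image (hVcl _ hw hw')
    rw [bundlePoint_self] at h1
    exact closure_mono hsub h1
  · have h1 := interior_subset hint
    rw [hfut] at h1
    exact (connectedComponentIn_subset _ _ h1).2.ne hw0

/-- The regularity that the Lagrange multiplier rule requires: the Ricci scalar is a trace of
derivatives of N, which is smooth for v ≠ 0. -/
theorem contDiffAt_ricciScalar [FiniteDimensional ℝ E] {p : M} {v : E} (hv : v ≠ 0) :
    ContDiffAt ℝ 1 (fun u : E => S.ricciScalar p u) v := by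
  have hpt := (chartAt E p).map_source (mem_chart_source E p)
  have hN := (S.isLocalFinsler p).contDiffAt_nonlinConn hpt hv
  have h1 : ContDiffAt ℝ ∞ (hLiftN (lagInChart S.L p)) (chartAt E p p, v) :=
    (contDiffAt_hDiff hN).sub ((contDiffAt_vDiff hN).clm_comp hN)
  have h2 : ContDiffAt ℝ ∞ (fun u : E => hLiftN (lagInChart S.L p) (chartAt E p p, u)) v :=
    ContDiffAt.comp (g := hLiftN (lagInChart S.L p)) v h1 (contDiffAt_const.prodMk contDiffAt_id)
  have h3 : ContDiffAt ℝ ∞ (fun u : E => (hLiftN (lagInChart S.L p) (chartAt E p p, u)).flip) v :=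
    ((ContinuousLinearMap.flipₗᵢ ℝ E E E).toContinuousLinearEquiv.contDiff.contDiffAt).comp v h2
  have h4 : ContDiffAt ℝ ∞ (fun u : E => nonlinCurv (lagInChart S.L p) (chartAt E p p, u) u) v :=
    (h3.clm_apply contDiffAt_id).sub (h2.clm_apply contDiffAt_id)
  let tr : (E →L[ℝ] E) →L[ℝ] ℝ := LinearMap.toContinuousLinearMap
    ((LinearMap.trace ℝ E).comp (ContinuousLinearMap.coeLM ℝ))
  exact ((tr.contDiff.contDiffAt).comp v h4).of_le ENat.LEInfty.out

namespace IsNullNormalField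

variable {S} {H U : Set M} {n : (q : M) → TangentSpace 𝓘(ℝ, E) q}
  (hn : S.IsNullNormalField H U n)
include hn

theorem contDiffAt_metricInChart {p : M} (hp : p ∈ U) (h0 : n p ≠ 0) :
    ContDiffAt ℝ 1 (metricInChart (S.pullbackMetric n) p) (chartAt E p p) := by
  have hps := mem_chart_source E p
  have hnc : ContDiffAt ℝ 1 (vecInChart n p) (chartAt E p p) :=
    contDiffAt_vecInChart hps (hn.contDiff.contMDiffAt (hn.isOpen.mem_nhds hp))
  refine ContDiffAt.congr_of_eventuallyEq ?_ (hn.metricInChart_eventuallyEq hps hp h0)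
  have hv : vecInChart n p (chartAt E p p) ≠ 0 := by
    rw [vecInChart_self]
    exact h0
  exact ContDiffAt.comp (g := vDiff (vDiff (lagInChart S.L p))) (chartAt E p p)
    (((S.isLocalFinsler p).contDiffAt_metric ((chartAt E p).map_source hps) hv).of_le
      ENat.LEInfty.out) (contDiffAt_id.prodMk hnc)

theorem continuousAt_metric {p : M} (hp : p ∈ U) (h0 : n p ≠ 0)
    {A B : (q : M) → TangentSpace 𝓘(ℝ, E) q} (hA : IsContVectorFieldOn A U)
    (hB : IsContVectorFieldOn B U) :
    ContinuousAt (fun q => S.pullbackMetric n q (A q) (B q)) p := by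
  have hps := mem_chart_source E p
  have h1 : ContinuousAt (fun q => metricInChart (S.pullbackMetric n) p (chartAt E p q)) p :=
    ContinuousAt.comp (g := metricInChart (S.pullbackMetric n) p)
      (hn.contDiffAt_metricInChart hp h0).continuousAt ((chartAt E p).continuousAt hps)
  have hA' := continuousAt_toCoords (hA.continuousAt (hn.isOpen.mem_nhds hp))
  have hB' := continuousAt_toCoords (hB.continuousAt (hn.isOpen.mem_nhds hp))
  refine ((h1.clm_apply hA').clm_apply hB').congr ?_
  filter_upwards [(chartAt E p).open_source.mem_nhds hps] with q hq
  have h2 : ∀ a b : E, metricInChart (S.pullbackMetric n) p (chartAt E p q) a b =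
      S.pullbackMetric n q (ofCoords p q a) (ofCoords p q b) := by
    intro a b
    rw [metricInChart, (chartAt E p).left_inv hq]
    rfl
  rw [h2, ofCoords_toCoords hq, ofCoords_toCoords hq]

theorem exists_isOpen_timelike {T : (q : M) → TangentSpace 𝓘(ℝ, E) q}
    (hTU : IsContVectorFieldOn T U)
    (hT : ∀ p ∈ H, S.pullbackMetric n p (T p) (T p) < 0 ∧ S.pullbackMetric n p (n p) (T p) < 0) :
    ∃ W : Set M, IsOpen W ∧ H ⊆ W ∧ W ⊆ U ∧ ∀ q ∈ W,
      S.pullbackMetric n q (T q) (T q) < 0 ∧ S.pullbackMetric n q (n q) (T q) < 0 := by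
  refine ⟨interior {q | q ∈ U ∧ S.pullbackMetric n q (T q) (T q) < 0 ∧
    S.pullbackMetric n q (n q) (T q) < 0}, isOpen_interior, fun p hp => ?_,
    fun q hq => (interior_subset hq).1, fun q hq => (interior_subset hq).2⟩
  have hpU := hn.subset hp
  have h0 := hn.ne_zero hp
  rw [mem_interior_iff_mem_nhds]
  filter_upwards [hn.isOpen.mem_nhds hpU,
    (hn.continuousAt_metric hpU h0 hTU hTU).eventually_lt_const (hT p hp).1,
    (hn.continuousAt_metric hpU h0 hn.contDiff.continuousOn hTU).eventually_lt_const (hT p hp).2]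
    with q h1 h2 h3 using ⟨h1, h2, h3⟩

/-- The inequality g_n(n, T) < 0 forces n ≠ 0 on all of `W`, which is what makes `g_n` Lorentzian
and `C^1` away from `H` too. -/
theorem isSpacetime {T : (q : M) → TangentSpace 𝓘(ℝ, E) q} (hTU : IsContVectorFieldOn T U)
    {W : Set M} (hW : IsOpen W) (hWU : W ⊆ U) (hT : ∀ q ∈ W,
      S.pullbackMetric n q (T q) (T q) < 0 ∧ S.pullbackMetric n q (n q) (T q) < 0) :
    Lorentz.IsSpacetime W (S.pullbackMetric n) T := by
  have h0 : ∀ q ∈ W, n q ≠ 0 := by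
    intro q hq h
    have := (hT q hq).2
    rw [h, map_zero] at this
    exact lt_irrefl _ this
  exact ⟨hW, fun p hp => hn.contDiffAt_metricInChart (hWU hp) (h0 p hp),
    fun p hp => S.lorentzian p (n p) (h0 p hp), hTU.mono hWU, fun p hp => (hT p hp).1⟩

theorem isNullNormal_metric {T : (q : M) → TangentSpace 𝓘(ℝ, E) q} {p : M} (hp : p ∈ H)
    (hT : S.pullbackMetric n p (n p) (T p) < 0) :
    Lorentz.IsNullNormal (S.pullbackMetric n) T H p (n p) :=
  ⟨⟨hn.ne_zero hp, (hn.mem_tangent_iff hp _).1 (hn.normal p hp).2.1, hT⟩, (hn.normal p hp).2.1,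
    hn.mem_tangent_iff hp⟩

omit hn in
/-- On a totally geodesic null hypersurface, `D n = Ω ⊗ n` for a `1`-form `Ω`. -/
theorem exists_connectionForm (h0 : ∀ p ∈ H, n p ≠ 0) (hg : S.IsTotallyGeodesic H n) :
    ∃ Ω : (p : M) → tangentSpaceOf (E := E) H p →ₗ[ℝ] ℝ,
      ∀ p ∈ H, ∀ X : tangentSpaceOf (E := E) H p, S.covD n p X = Ω p X • n p := by
  have key : ∀ p : M, ∃ θ : tangentSpaceOf (E := E) H p →ₗ[ℝ] ℝ,
      p ∈ H → ∀ X : tangentSpaceOf (E := E) H p, S.covD n p X = θ X • n p := by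
    intro p
    by_cases hp : p ∈ H
    · obtain ⟨v, hv⟩ : ∃ v : E, v = n p := ⟨_, rfl⟩
      -- A functional with ξ(n) = 1 reads off the coefficient of D_X n along n linearly in X.
      obtain ⟨ξ, hξ⟩ : ∃ ξ : E →L[ℝ] ℝ, ξ v = 1 :=
        SeparatingDual.exists_eq_one (hv ▸ h0 p hp)
      let A : E →L[ℝ] E := fderiv ℝ (vecInChart n p) (chartAt E p p) +
        nonlinConn (lagInChart S.L p) (chartAt E p p, v)
      have hA : ∀ X : TangentSpace 𝓘(ℝ, E) p, S.covD n p X = A X := by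
        intro X
        simp only [A, hv]
        rfl
      refine ⟨((ξ.comp A : E →L[ℝ] ℝ) : E →ₗ[ℝ] ℝ).comp (tangentSpaceOf (E := E) H p).subtype,
        fun _ X => ?_⟩
      obtain ⟨c, hc⟩ := Submodule.mem_span_singleton.1 (hg p hp X X.2)
      have h1 : A (X : TangentSpace 𝓘(ℝ, E) p) = c • v := by
        rw [hv, ← hA]
        exact hc.symm
      have h2 : ξ (A (X : TangentSpace 𝓘(ℝ, E) p)) = c := by rw [h1, map_smul, hξ, smul_eq_mul, mul_one]
      rw [← hc]
      exact congrArg (fun r : ℝ => r • n p) h2.symm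
    · exact ⟨0, fun hp' => absurd hp' hp⟩
  choose Ω hΩ using key
  exact ⟨Ω, hΩ⟩

variable [FiniteDimensional ℝ E]

/-- If `D n = Ω ⊗ n` on `H`, then `Ric_n = i_n dΩ` on `H`. -/
theorem ricciForm_eq_extD {p : M} (hp : p ∈ H) {Ω : (q : M) → TangentSpace 𝓘(ℝ, E) q →L[ℝ] ℝ}
    (hΩ : ContDiffAt ℝ 1 (formInChart Ω p) (chartAt E p p))
    (h : ∀ᶠ q in 𝓝[H] p, ∀ X ∈ tangentSpaceOf (E := E) H q, S.covD n q X = Ω q X • n q)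
    {X : TangentSpace 𝓘(ℝ, E) p} (hX : X ∈ tangentSpaceOf H p) :
    S.ricciForm p (n p) X = extD Ω p (n p) X := by
  have hps := mem_chart_source E p
  have hpt := (chartAt E p).map_source hps
  have hN := hn.isLocalNull hps hp
  -- The hypothesis at a nearby q is stated in the preferred chart of q; `toCoords_covD` moves it to
  -- the chart of p, where it can be differentiated.
  have hloc : ∀ᶠ y in 𝓝[setInChart H p] (chartAt E p p),
      ∀ a ∈ localTangent (setInChart H p) y, fderiv ℝ (vecInChart n p) y a +
        nonlinConn (lagInChart S.L p) (y, vecInChart n p y) a =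
          formInChart Ω p y a • vecInChart n p y := by
    filter_upwards [(tendsto_chart_symm hps).eventually h, self_mem_nhdsWithin] with y hy hyH a ha
    have hs := (chartAt E p).map_target hyH.1
    have e1 := mem_localTangent_iff (H := H) hs (ofCoords p _ a)
    have e2 := hn.toCoords_covD hyH.2 hs (ofCoords p _ a)
    rw [toCoords_ofCoords hs, (chartAt E p).right_inv hyH.1] at e1 e2
    rw [← e2, hy _ (e1.1 ha), map_smul]
    rfl
  have hXα : vDiff (lagInChart S.L p) (chartAt E p p, vecInChart n p (chartAt E p p)) X = 0 := by
    have := S.conormal_chart hps (hn.ne_zero hp) X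
    rw [toCoords_self, (hn.mem_tangent_iff hp X).1 hX] at this
    exact this
  have key := hN.trace_nonlinCurv (S.isLocalFinsler p) hpt hΩ hloc hXα
  rw [vecInChart_self] at key
  exact key

/-- Since Ric(n) = dΩ(n, n) = 0 is the least value of Ric on the future light cone, the first-order
condition for this constrained minimum, read through the Ricci equation, kills Ric_n on T`H`. -/
theorem extD_eq_zero (hnc : S.NullConvergence) (hric : S.RicciEquation) {p : M} (hp : p ∈ H)
    {Ω : (q : M) → TangentSpace 𝓘(ℝ, E) q →L[ℝ] ℝ}
    (hΩ : ContDiffAt ℝ 1 (formInChart Ω p) (chartAt E p p))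
    (h : ∀ᶠ q in 𝓝[H] p, ∀ X ∈ tangentSpaceOf (E := E) H q, S.covD n q X = Ω q X • n q)
    {X : TangentSpace 𝓘(ℝ, E) p} (hX : X ∈ tangentSpaceOf H p) :
    extD Ω p (n p) X = 0 := by
  have hps := mem_chart_source E p
  have hpt := (chartAt E p).map_source hps
  have hℓ := S.isLocalFinsler p
  obtain ⟨v, hv⟩ : ∃ v : E, v = n p := ⟨_, rfl⟩
  have hv0 : v ≠ 0 := hv ▸ hn.ne_zero hp
  have hvc : vecInChart n p (chartAt E p p) = v := (vecInChart_self n p).trans hv.symm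
  have hN := hn.isLocalNull hps hp
  have hf : ContDiffAt ℝ 1 (fun u : E => lagInChart S.L p (chartAt E p p, u)) v :=
    ContDiffAt.comp (g := lagInChart S.L p) v ((hℓ.contDiffAt hpt hv0).of_le ENat.LEInfty.out)
      (contDiffAt_const.prodMk contDiffAt_id)
  have hf' : fderiv ℝ (fun u : E => lagInChart S.L p (chartAt E p p, u)) v =
      vDiff (lagInChart S.L p) (chartAt E p p, v) :=
    (vDiff_eq_fderiv ((hℓ.contDiffAt hpt hv0).differentiableAt (by simp))).symm
  have hfv : lagInChart S.L p (chartAt E p p, v) = 0 := by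
    have h1 := hN.null.self_of_nhdsWithin hN.mem
    rw [hvc, hℓ.vDiff_self hpt hv0] at h1
    linarith
  have hlv : S.IsFutureLightlike p v := hv ▸ (hn.normal p hp).1
  have hRv : S.ricciScalar p v = 0 := by
    have h1 := hn.ricciForm_eq_extD hp hΩ h (hn.normal p hp).2.1
    rw [extD, sub_self] at h1
    rw [hv]
    exact h1
  have hmin : IsLocalExtrOn (fun u : E => S.ricciScalar p u)
      {u | lagInChart S.L p (chartAt E p p, u) = lagInChart S.L p (chartAt E p p, v)} v := by
    left
    have h1 := S.eventually_isFutureLightlike hlv ((S.lagInChart_self p v).symm.trans hfv)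
    filter_upwards [nhdsWithin_le_nhds h1, self_mem_nhdsWithin] with u hu hu0
    rw [hRv]
    refine hnc p u (hu ?_)
    rw [← S.lagInChart_self]
    exact hu0.trans hfv
  obtain ⟨a, b, hab, heq⟩ := hmin.exists_multipliers_of_hasStrictFDerivAt_1d
    (hf.hasStrictFDerivAt (by simp)) ((S.contDiffAt_ricciScalar hv0).hasStrictFDerivAt (by simp))
  rw [hf'] at heq
  -- The constraint is regular at n, its differential being the nonzero conormal, so the multiplier
  -- of dRic cannot vanish.
  have hb : b ≠ 0 := by
    rintro rfl
    rw [zero_smul, add_zero] at heq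
    rcases smul_eq_zero.1 heq with h1 | h1
    · exact hab (by rw [h1]; rfl)
    · exact hN.conormal_ne_zero hℓ hpt (by rw [hvc]; exact h1)
  have hXα : vDiff (lagInChart S.L p) (chartAt E p p, v) X = 0 := by
    have := S.conormal_chart hps (hn.ne_zero hp) X
    rw [toCoords_self, (hn.mem_tangent_iff hp X).1 hX, hvc] at this
    exact this
  have h2 : fderiv ℝ (fun u : E => S.ricciScalar p u) v X = 0 := by
    have h3 := congrArg (fun A : E →L[ℝ] ℝ => A X) heq
    change a * vDiff (lagInChart S.L p) (chartAt E p p, v) X +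
      b * fderiv ℝ (fun u : E => S.ricciScalar p u) v X = 0 at h3
    rw [hXα, mul_zero, zero_add] at h3
    exact (mul_eq_zero.1 h3).resolve_left hb
  have h4 := hric p v hv0 X
  have h5 : S.ricciForm p v X = 0 := by
    have := h4.symm.trans h2
    linarith
  rw [← hn.ricciForm_eq_extD hp hΩ h hX, ← h5, hv]

end IsNullNormalField

end FinslerSpacetime

end Global

end FinslerNull

end

/-! ### Assembly of the theorem. -/

theorem mainTheorem5
    {E : Type*} [NormedAddCommGroup E] [NormedSpace ℝ E] [FiniteDimensional ℝ E]
    {M : Type*} [TopologicalSpace M] [ChartedSpace E M] [IsManifold 𝓘(ℝ, E) ∞ M]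
    [T2Space M] [ParacompactSpace M] [ConnectedSpace M]
    (S : FinslerNull.FinslerSpacetime E M)
    -- the null hypersurface, its tangent lightlike field `n`, and `T`, both extended to `U`
    (H U : Set M) (n T : (q : M) → TangentSpace 𝓘(ℝ, E) q)
    (hH : S.IsNullHypersurface H)
    (hU : IsOpen U) (hHU : H ⊆ U)
    (hnU : FinslerNull.IsC1VectorFieldOn n U)
    (hTU : FinslerNull.IsContVectorFieldOn T U)
    (hn : ∀ p ∈ H, S.IsNullNormal H p (n p))
    (hT : ∀ p ∈ H, S.pullbackMetric n p (T p) (T p) < 0 ∧ S.pullbackMetric n p (n p) (T p) < 0) :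
    -- after shrinking `U`, the inequalities hold on it
    (∃ W : Set M, IsOpen W ∧ H ⊆ W ∧ W ⊆ U ∧ ∀ q ∈ W,
      S.pullbackMetric n q (T q) (T q) < 0 ∧ S.pullbackMetric n q (n q) (T q) < 0) ∧
    -- whenever they do, `(W, g_n)` is a spacetime and `H` a null hypersurface in it, with the
    -- same lightlike field
    (∀ W : Set M, IsOpen W → H ⊆ W → W ⊆ U →
      (∀ q ∈ W, S.pullbackMetric n q (T q) (T q) < 0 ∧ S.pullbackMetric n q (n q) (T q) < 0) →
      FinslerNull.Lorentz.IsSpacetime W (S.pullbackMetric n) T ∧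
      FinslerNull.Lorentz.IsNullHypersurface (S.pullbackMetric n) T W H ∧
      ∀ p ∈ H, FinslerNull.Lorentz.IsNullNormal (S.pullbackMetric n) T H p (n p)) ∧
    -- totally geodesic in one spacetime iff in the other
    (S.IsTotallyGeodesic H n ↔ FinslerNull.Lorentz.IsTotallyGeodesic (S.pullbackMetric n) H) ∧
    -- the two covariant derivatives of `n` coincide on `H`
    (∀ p ∈ H, ∀ X : TangentSpace 𝓘(ℝ, E) p,
      S.covD n p X = FinslerNull.Lorentz.nabla (S.pullbackMetric n) n p X) ∧
    -- same surface gravity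
    (∃ κ : M → ℝ, ∀ p ∈ H, S.covD n p (n p) = κ p • n p ∧
      FinslerNull.Lorentz.nabla (S.pullbackMetric n) n p (n p) = κ p • n p) ∧
    -- same 1-form `Ω` on `H` in the totally geodesic case
    (S.IsTotallyGeodesic H n →
      ∃ Ω : (p : M) → FinslerNull.tangentSpaceOf (E := E) H p →ₗ[ℝ] ℝ,
        ∀ p ∈ H, ∀ X : FinslerNull.tangentSpaceOf (E := E) H p,
          S.covD n p X = Ω p X • n p ∧
          FinslerNull.Lorentz.nabla (S.pullbackMetric n) n p X = Ω p X • n p) ∧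
    -- same affine parametrizations of the generators
    (∀ (J : Set ℝ) (γ : ℝ → M) (α : ℝ → ℝ), IsOpen J → J.OrdConnected →
      (∀ t ∈ J, γ t ∈ H ∧ 0 < α t ∧ HasMFDerivAt 𝓘(ℝ, ℝ) 𝓘(ℝ, E) γ t
        ((1 : ℝ →L[ℝ] ℝ).smulRight (α t • n (γ t)))) →
      (S.IsGeodesicOn γ J ↔ FinslerNull.Lorentz.IsGeodesicOn (S.pullbackMetric n) γ J)) ∧
    -- `i_n dΩ = 0` in the totally geodesic case, if the null convergence condition and the
    -- equation `∂Ric/∂v = 2 Ric_v` hold; here `Ω` is represented near `p` by any `C^1` 1-form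
    -- of the ambient manifold that restricts to it on `H`
    (S.NullConvergence → S.RicciEquation → S.IsTotallyGeodesic H n →
      ∀ p ∈ H, ∀ Ω : (q : M) → TangentSpace 𝓘(ℝ, E) q →L[ℝ] ℝ,
        ContDiffAt ℝ 1 (FinslerNull.formInChart Ω p) (chartAt E p p) →
        (∀ᶠ q in 𝓝[H] p, ∀ X ∈ FinslerNull.tangentSpaceOf (E := E) H q,
          S.covD n q X = Ω q X • n q) →
        ∀ X ∈ FinslerNull.tangentSpaceOf (E := E) H p,
          FinslerNull.extD Ω p (n p) X = 0) := by
  have h : S.IsNullNormalField H U n := ⟨hH, hU, hHU, hnU, hn⟩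
  refine ⟨h.exists_isOpen_timelike hTU hT, fun W hW hHW hWU hTW => ?_, h.isTotallyGeodesic_iff,
    fun p hp X => h.covD_eq_nabla hp X, ?_, fun hg => ?_,
    fun J γ α _ _ hγ => h.isGeodesicOn_iff hγ,
    fun hnc hric _ p hp Ω hΩ hΩH X hX => h.extD_eq_zero hnc hric hp hΩ hΩH hX⟩
  · have hnn : ∀ p ∈ H, FinslerNull.Lorentz.IsNullNormal (S.pullbackMetric n) T H p (n p) :=
      fun p hp => h.isNullNormal_metric hp (hT p hp).2
    exact ⟨h.isSpacetime hTU hW hWU hTW, ⟨hHW, hH.1, fun p hp => ⟨n p, hnn p hp⟩⟩, hnn⟩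
  -- The factor is chosen point by point, with the value 0 off `H`.
  · have hκ : ∀ p : M, ∃ c : ℝ, p ∈ H → c • n p = S.covD n p (n p) := by
      intro p
      by_cases hp : p ∈ H
      · obtain ⟨c, hc⟩ := Submodule.mem_span_singleton.1 (h.covD_self_mem_span hp)
        exact ⟨c, fun _ => hc⟩
      · exact ⟨0, fun hp' => absurd hp' hp⟩
    choose κ hκ using hκ
    refine ⟨κ, fun p hp => ⟨(hκ p hp).symm, ?_⟩⟩
    rw [← h.covD_eq_nabla hp, hκ p hp]
  · obtain ⟨Ω, hΩ⟩ := FinslerNull.FinslerSpacetime.IsNullNormalField.exists_connectionForm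
      (fun p hp => h.ne_zero hp) hg
    refine ⟨Ω, fun p hp X => ⟨hΩ p hp X, ?_⟩⟩
    rw [← h.covD_eq_nabla hp, hΩ p hp X]
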